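/- Let $n\ge 2$ and $\sigma\in(\tfrac12,1)$. For an open set $\Omega\subset\mathbb{R}^n$ and a measurable $u:\Omega\to\mathbb{R}$ put \[ I_{n,\sigma,\Omega}[u]=\iint_{\Omega\times\Omega}\frac{(u(x)-u(y))^2}{|x-y|^{n+2\sigma}}\,dx\,dy . \] For bounded $\Omega$ let $\mathring H^\sigma(\Omega)$ be the completion of $C^1_c(\Omega)$ with respect to $I_{n,\sigma,\Omega}$, realised in $L^2(\Omega)$: it consists of those $u\in L^2(\Omega)$ for which there are $\varphi_k\in C^1_c(\Omega)$ with $\varphi_k\to u$ in $L^2(\Omega)$ and $I_{n,\sigma,\Omega}[\varphi_k-u]\to0$. A real number $\lambda$ is a (Dirichlet) eigenvalue of the regional fractional Laplacian on $\Omega$ if there is a nonzero $u\in\mathring H^\sigma(\Omega)$ such that \[ \iint_{\Omega\times\Omega}\frac{(u(x)-u(y))(\varphi(x)-\varphi(y))}{|x-y|^{n+2\sigma}}\,dx\,dy=\lambda\int_\Omega u\varphi\,dx\qquad\text{for all }\varphi\in\mathring H^\sigma(\Omega), \] and the first eigenvalue $\lambda_{1,\sigma}(\Omega)$ is the smallest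 eigenvalue. Then every convex open set $\Omega\subset\mathbb{R}^n$ with $|\Omega|=1$ (such a set is bounded) has a smallest eigenvalue $\lambda_{1,\sigma}(\Omega)$, and there exists a convex open set $\Omega_0\subset\mathbb{R}^n$ with $|\Omega_0|=1$ that achieves \[ \inf\{\lambda_{1,\sigma}(\Omega):\ \Omega\subset\mathbb{R}^n\text{ is a convex open set and }|\Omega|=1\}. \] -/

import Mathlib

open MeasureTheory Filter Topology
open scoped ENNReal

noncomputable section

/-- `C¹_c(Ω)`, the real `C¹` functions whose (closed) support is a compact subset of `Ω`. -/
def C1c {n : ℕ} (Ω : Set (EuclideanSpace ℝ (Fin n))) : Set (EuclideanSpace ℝ (Fin n) → ℝ) :=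
  {φ | ContDiff ℝ 1 φ ∧ HasCompactSupport φ ∧ tsupport φ ⊆ Ω}

/-- Lebesgue measure on `Ω × Ω`. -/
def prodMeasure {n : ℕ} (Ω : Set (EuclideanSpace ℝ (Fin n))) :
    Measure (EuclideanSpace ℝ (Fin n) × EuclideanSpace ℝ (Fin n)) :=
  (volume.restrict Ω).prod (volume.restrict Ω)

/-- The regional energy `I_{n,σ,Ω}[u] = ∬_{Ω×Ω} (u(x)-u(y))² / |x-y|^{n+2σ} dx dy ∈ [0,∞]`. -/
def regionalEnergy {n : ℕ} (σ : ℝ) (Ω : Set (EuclideanSpace ℝ (Fin n)))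
    (u : EuclideanSpace ℝ (Fin n) → ℝ) : ℝ≥0∞ :=
  ∫⁻ p, ENNReal.ofReal ((u p.1 - u p.2) ^ 2 / ‖p.1 - p.2‖ ^ ((n : ℝ) + 2 * σ)) ∂(prodMeasure Ω)

/-- The symmetric bilinear form
`∬_{Ω×Ω} (u(x)-u(y)) (φ(x)-φ(y)) / |x-y|^{n+2σ} dx dy` of the regional energy. The integral
converges absolutely if `u` and `φ` are measurable on `Ω` and have finite regional energy. -/
def regionalForm {n : ℕ} (σ : ℝ) (Ω : Set (EuclideanSpace ℝ (Fin n)))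
    (u φ : EuclideanSpace ℝ (Fin n) → ℝ) : ℝ :=
  ∫ p, (u p.1 - u p.2) * (φ p.1 - φ p.2) / ‖p.1 - p.2‖ ^ ((n : ℝ) + 2 * σ) ∂(prodMeasure Ω)

/-- The space `H̊^σ(Ω)`: the completion of `C¹_c(Ω)` with respect to the regional energy, realised
inside `L²(Ω)`. For `n ≥ 2`, `1/2 < σ < 1` and `Ω` bounded the regional energy controls the `L²(Ω)`
norm on `C¹_c(Ω)`, so the completion is the set of `L²(Ω)` functions that are limits, both in
`L²(Ω)` and in energy, of sequences in `C¹_c(Ω)`.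
Only the values of `u` on `Ω`, up to null sets, matter. -/
def HRing {n : ℕ} (σ : ℝ) (Ω : Set (EuclideanSpace ℝ (Fin n))) :
    Set (EuclideanSpace ℝ (Fin n) → ℝ) :=
  {u | MemLp u 2 (volume.restrict Ω) ∧
    ∃ φ : ℕ → EuclideanSpace ℝ (Fin n) → ℝ, (∀ k, φ k ∈ C1c Ω) ∧
      Tendsto (fun k => eLpNorm (φ k - u) 2 (volume.restrict Ω)) atTop (𝓝 0) ∧
      Tendsto (fun k => regionalEnergy σ Ω (φ k - u)) atTop (𝓝 0)}

/-- `u` is an eigenfunction with eigenvalue `l` of the regional fractional Laplacian on `Ω` with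
Dirichlet boundary condition: `u ∈ H̊^σ(Ω)` is not zero, and it is a weak solution of
`(-Δ)_Ω^σ u = l u` in `Ω`, `u = 0` on `∂Ω`, where
`(-Δ)_Ω^σ u (x) = 2 lim_{ε → 0} ∫_{y ∈ Ω, |x-y| ≥ ε} (u(x)-u(y)) / |x-y|^{n+2σ} dy`.
(The factor `2` is absorbed by the symmetrisation that leads to `regionalForm`.) -/
def IsEigenfunction {n : ℕ} (σ : ℝ) (Ω : Set (EuclideanSpace ℝ (Fin n))) (l : ℝ)
    (u : EuclideanSpace ℝ (Fin n) → ℝ) : Prop :=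
  u ∈ HRing σ Ω ∧ ¬ (u =ᵐ[volume.restrict Ω] 0) ∧
    ∀ φ ∈ HRing σ Ω, regionalForm σ Ω u φ = l * ∫ x in Ω, u x * φ x

/-- The set of Dirichlet eigenvalues of the regional fractional Laplacian on `Ω`. -/
def eigenvalues {n : ℕ} (σ : ℝ) (Ω : Set (EuclideanSpace ℝ (Fin n))) : Set ℝ :=
  {l | ∃ u, IsEigenfunction σ Ω l u}

/-- The first eigenvalue `λ_{1,σ}(Ω)`, the smallest Dirichlet eigenvalue of the regional fractional
Laplacian on `Ω` (meaningful where the set of eigenvalues has a least element). -/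
def firstEigenvalue {n : ℕ} (σ : ℝ) (Ω : Set (EuclideanSpace ℝ (Fin n))) : ℝ :=
  sInf (eigenvalues σ Ω)

/-- The convex open subsets of `ℝⁿ` of volume `1`. -/
def convexUnitVolume (n : ℕ) : Set (Set (EuclideanSpace ℝ (Fin n))) :=
  {Ω | Convex ℝ Ω ∧ IsOpen Ω ∧ volume Ω = 1}

end

-- The proof is the direct method, applied twice: to functions on a fixed domain and then to
-- domains.
--
-- The basic tool is a fractional Hardy inequality, valid for `σ > 1/2` with a constant that depends
-- on `σ` alone: the energy of a test function on the whole space is at most a constant times its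
-- regional energy (`exists_regionalEnergy_univ_le`). Let `E(h)` be the mass of `f²` on the points
-- of `Ω` that leave `Ω` under translation by `-h`. A point that leaves after two steps leaves
-- either at the first step or at the second, so `E(2h) ≤ (2 + ε) E(h)` up to a squared difference
-- inside `Ω`. Integrated against `|h|^{-(n+2σ)}`, the left side becomes `2^{2σ}` times the integral
-- of `E`; as `2^{2σ} > 2`, the term with `E` can be absorbed. No regularity of the boundary enters.
--
-- Energy bounds on the whole space give compactness in `L²`
-- (`exists_subseq_tendsto_of_energy_bounded`), and Fatou's lemma gives lower semicontinuity. On a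
-- bounded open set the infimum `rayleighInf` of the Rayleigh quotient is therefore attained in
-- `HRing`, and it is the least eigenvalue (`isLeast_eigenvalues`).
--
-- Along a minimizing sequence of convex domains of volume 1, Hardy also prevents thinning: a domain
-- that fills at most half of every small ball centred in it has large energy. So each domain fills
-- more than half of a ball of fixed radius, and convexity with volume 1 then bounds its diameter.
-- Blaschke selection, followed by homotheties with ratios tending to 1, puts a subsequence inside
-- its limit `Ω₀` so that it exhausts `Ω₀` (`exists_subseq_homothety`). The energies change by
-- factors tending to 1, and the compactness argument, stated for varying subdomains
-- (`exists_mem_HRing_of_tendsto`), gives a function on `Ω₀` whose energy is at most the infimum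
-- over all domains.

local notation "𝔼" n => EuclideanSpace ℝ (Fin n)

/-! ### The kernel, its homogeneity, and the energy as an integral over translations -/

/-- The kernel `|h|^{-(n+2σ)}` of the regional energy. -/
noncomputable def kern {n : ℕ} (σ : ℝ) (h : 𝔼 n) : ℝ≥0∞ :=
  ENNReal.ofReal ((‖h‖ ^ ((n : ℝ) + 2 * σ))⁻¹)

theorem measurable_kern {n : ℕ} (σ : ℝ) : Measurable (kern σ : (𝔼 n) → ℝ≥0∞) := by
  unfold kern; fun_prop

theorem kern_neg {n : ℕ} (σ : ℝ) (h : 𝔼 n) : kern σ (-h) = kern σ h := by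
  simp [kern]

theorem ofReal_energy_integrand {n : ℕ} (σ : ℝ) (a : ℝ) (h : 𝔼 n) :
    ENNReal.ofReal (a ^ 2 / ‖h‖ ^ ((n : ℝ) + 2 * σ)) = ENNReal.ofReal (a ^ 2) * kern σ h := by
  rw [kern, ← ENNReal.ofReal_mul (sq_nonneg a), div_eq_mul_inv]

theorem kern_smul {n : ℕ} (σ : ℝ) {t : ℝ} (ht : 0 < t) (h : 𝔼 n) :
    kern σ (t • h) = ENNReal.ofReal (t ^ (-((n : ℝ) + 2 * σ))) * kern σ h := by
  rw [kern, kern, ← ENNReal.ofReal_mul (by positivity), norm_smul, Real.norm_of_nonneg ht.le,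
    Real.mul_rpow ht.le (norm_nonneg _), Real.rpow_neg ht.le, mul_inv]

theorem regionalEnergy_eq {n : ℕ} (σ : ℝ) (Ω : Set (𝔼 n)) (u : (𝔼 n) → ℝ) :
    regionalEnergy σ Ω u = ∫⁻ p in Ω ×ˢ Ω, ENNReal.ofReal ((u p.1 - u p.2) ^ 2) *
      kern σ (p.1 - p.2) ∂(volume.prod volume) := by
  simp only [regionalEnergy, ofReal_energy_integrand, prodMeasure, Measure.prod_restrict]

/-- Change of variables `y = x - h` in a double integral against the kernel. -/
theorem lintegral_mul_kern_sub {n : ℕ} (σ : ℝ) {G : (𝔼 n) × (𝔼 n) → ℝ≥0∞} (hG : Measurable G) :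
    ∫⁻ p, G p * kern σ (p.1 - p.2) ∂(volume.prod volume) =
      ∫⁻ h, kern σ h * ∫⁻ x, G (x, x - h) := by
  have hk := measurable_kern (n := n) σ
  rw [lintegral_prod _ (by fun_prop)]
  have h1 : ∀ x : 𝔼 n, ∫⁻ y, G (x, y) * kern σ (x - y) = ∫⁻ h, G (x, x - h) * kern σ h := by
    intro x
    rw [← lintegral_sub_left_eq_self (fun y => G (x, y) * kern σ (x - y)) x]
    simp
  simp only [h1]
  rw [lintegral_lintegral_swap (by fun_prop)]
  refine lintegral_congr fun h => ?_
  rw [lintegral_mul_const _ (by fun_prop), mul_comm]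

theorem regionalEnergy_eq_translates {n : ℕ} (σ : ℝ) {Ω : Set (𝔼 n)} (hΩ : MeasurableSet Ω)
    {u : (𝔼 n) → ℝ} (hu : Measurable u) :
    regionalEnergy σ Ω u = ∫⁻ h, kern σ h *
      ∫⁻ x, (Ω ×ˢ Ω).indicator (fun p => ENNReal.ofReal ((u p.1 - u p.2) ^ 2)) (x, x - h) := by
  rw [← lintegral_mul_kern_sub σ (Measurable.indicator (by fun_prop) (hΩ.prod hΩ)),
    regionalEnergy_eq, ← lintegral_indicator (hΩ.prod hΩ)]
  refine lintegral_congr fun p => ?_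
  by_cases hp : p ∈ Ω ×ˢ Ω <;> simp [hp]

theorem regionalEnergy_univ_eq_translates {n : ℕ} (σ : ℝ) {u : (𝔼 n) → ℝ} (hu : Measurable u) :
    regionalEnergy σ Set.univ u = ∫⁻ h, kern σ h *
      ∫⁻ x, ENNReal.ofReal ((u x - u (x - h)) ^ 2) := by
  rw [regionalEnergy_eq_translates σ MeasurableSet.univ hu]; simp

theorem lintegral_comp_smul_eq {n : ℕ} {t : ℝ} (ht : 0 < t) {f : (𝔼 n) → ℝ≥0∞}
    (hf : Measurable f) :
    ∫⁻ h, f (t • h) = ENNReal.ofReal (t ^ (-(n : ℝ))) * ∫⁻ h, f h := by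
  have h := Measure.map_addHaar_smul (volume : Measure (𝔼 n)) ht.ne'
  rw [← lintegral_map (μ := volume) hf (measurable_const_smul t), h, lintegral_smul_measure,
    finrank_euclideanSpace_fin, abs_of_pos (by positivity), smul_eq_mul, Real.rpow_neg ht.le,
    Real.rpow_natCast]

/-- The kernel is homogeneous of degree `-(n + 2σ)` and the Jacobian is `t^{-n}`, which leaves
`t^{2σ}`. With `t = 2` this is the gain behind the Hardy inequality; with general `t` it is the
scaling law of the energy. -/
theorem lintegral_kern_mul_comp_smul {n : ℕ} (σ : ℝ) {t : ℝ} (ht : 0 < t) {f : (𝔼 n) → ℝ≥0∞}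
    (hf : Measurable f) :
    ∫⁻ h, kern σ h * f (t • h) = ENNReal.ofReal (t ^ (2 * σ)) * ∫⁻ h, kern σ h * f h := by
  have hk := measurable_kern (n := n) σ
  have h1 : ∀ h : 𝔼 n, kern σ h * f (t • h) =
      ENNReal.ofReal (t ^ ((n : ℝ) + 2 * σ)) * (kern σ (t • h) * f (t • h)) := by
    intro h
    rw [kern_smul σ ht, ← mul_assoc, ← mul_assoc, ← ENNReal.ofReal_mul (by positivity),
      ← Real.rpow_add ht]
    simp
  simp only [h1]
  rw [lintegral_const_mul _ (by fun_prop),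
    lintegral_comp_smul_eq ht (f := fun h => kern σ h * f h) (by fun_prop), ← mul_assoc,
    ← ENNReal.ofReal_mul (by positivity), ← Real.rpow_add ht]
  congr 3; ring

/-! ### The fractional Hardy inequality -/

/-- The mass of `f²` on the part of `Ω` that the translation by `-h` moves out of `Ω`. -/
noncomputable def escapeMass {n : ℕ} (Ω : Set (𝔼 n)) (f : (𝔼 n) → ℝ) (h : 𝔼 n) : ℝ≥0∞ :=
  ∫⁻ x, (Ω ×ˢ Ωᶜ).indicator (fun p => ENNReal.ofReal (f p.1 ^ 2)) (x, x - h)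

theorem measurable_escapeMass {n : ℕ} {Ω : Set (𝔼 n)} (hΩ : MeasurableSet Ω) {f : (𝔼 n) → ℝ}
    (hf : Measurable f) : Measurable (escapeMass Ω f) := by
  have h : Measurable ((Ω ×ˢ Ωᶜ).indicator (fun p : (𝔼 n) × (𝔼 n) => ENNReal.ofReal (f p.1 ^ 2))) :=
    Measurable.indicator (by fun_prop) (hΩ.prod hΩ.compl)
  have h2 : Measurable (Function.uncurry fun (h x : 𝔼 n) =>
    (Ω ×ˢ Ωᶜ).indicator (fun p => ENNReal.ofReal (f p.1 ^ 2)) (x, x - h)) :=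
    h.comp (by fun_prop)
  exact h2.lintegral_prod_right

theorem sq_le_one_add_mul {ε : ℝ} (hε : 0 < ε) (a b : ℝ) :
    a ^ 2 ≤ (1 + ε) * b ^ 2 + (1 + ε⁻¹) * (a - b) ^ 2 := by
  have h : 0 ≤ (ε * b - (a - b)) ^ 2 / ε := by positivity
  have e : (1 + ε) * b ^ 2 + (1 + ε⁻¹) * (a - b) ^ 2 - a ^ 2 = (ε * b - (a - b)) ^ 2 / ε := by
    field_simp; ring
  linarith

/-- Let `x ∈ Ω` and `x - 2h ∉ Ω`. If `x - h ∉ Ω`, then `x` already counts in the mass for `h`.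
Otherwise `x - h` counts there, and Young's inequality replaces `f(x)²` by `(1 + ε) f(x - h)²` plus
a squared difference between two points of `Ω`. The two cases together produce `2 + ε`. -/
theorem escapeMass_two_smul_le {n : ℕ} {Ω : Set (𝔼 n)} (hΩ : MeasurableSet Ω) {f : (𝔼 n) → ℝ}
    (hf : Measurable f) {ε : ℝ} (hε : 0 < ε) (h : 𝔼 n) :
    escapeMass Ω f ((2 : ℝ) • h) ≤ ENNReal.ofReal (2 + ε) * escapeMass Ω f h +
      ENNReal.ofReal (1 + ε⁻¹) * ∫⁻ x, (Ω ×ˢ Ω).indicator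
        (fun p => ENNReal.ofReal ((f p.1 - f p.2) ^ 2)) (x, x - h) := by
  have m1 : Measurable ((Ω ×ˢ Ωᶜ).indicator (fun p : (𝔼 n) × (𝔼 n) => ENNReal.ofReal (f p.1 ^ 2))) :=
    Measurable.indicator (by fun_prop) (hΩ.prod hΩ.compl)
  have m2 : Measurable ((Ω ×ˢ Ω).indicator
      (fun p : (𝔼 n) × (𝔼 n) => ENNReal.ofReal ((f p.1 - f p.2) ^ 2))) :=
    Measurable.indicator (by fun_prop) (hΩ.prod hΩ)
  set A := (Ω ×ˢ Ωᶜ).indicator (fun p : (𝔼 n) × (𝔼 n) => ENNReal.ofReal (f p.1 ^ 2))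
  set B := (Ω ×ˢ Ω).indicator
      (fun p : (𝔼 n) × (𝔼 n) => ENNReal.ofReal ((f p.1 - f p.2) ^ 2))
  have key : ∀ x, A (x, x - (2 : ℝ) • h) ≤ A (x, x - h) + (ENNReal.ofReal (1 + ε) *
      A (x - h, x - h - h) + ENNReal.ofReal (1 + ε⁻¹) * B (x, x - h)) := by
    intro x
    have e : x - (2 : ℝ) • h = x - h - h := by rw [two_smul]; abel
    rw [e]
    by_cases h0 : x ∈ Ω ∧ x - h - h ∉ Ω
    · by_cases h1 : x - h ∈ Ω
      · have : A (x, x - h - h) = ENNReal.ofReal (f x ^ 2) := by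
          simp [A, h0.1, h0.2]
        rw [this]
        have : A (x - h, x - h - h) = ENNReal.ofReal (f (x - h) ^ 2) := by
          simp [A, h1, h0.2]
        rw [this]
        have : B (x, x - h) = ENNReal.ofReal ((f x - f (x - h)) ^ 2) := by
          simp [B, h1, h0.1]
        rw [this, ← ENNReal.ofReal_mul (by positivity), ← ENNReal.ofReal_mul (by positivity),
          ← ENNReal.ofReal_add (by positivity) (by positivity)]
        exact le_add_left (ENNReal.ofReal_le_ofReal (sq_le_one_add_mul hε _ _))
      · have : A (x, x - h - h) = A (x, x - h) := by simp [A, h0.1, h0.2, h1]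
        rw [this]; exact le_self_add
    · have : A (x, x - h - h) = 0 := by
        simp only [A]; apply Set.indicator_of_notMem; simpa using h0
      rw [this]; exact zero_le
  calc escapeMass Ω f ((2 : ℝ) • h) ≤ ∫⁻ x, (A (x, x - h) + (ENNReal.ofReal (1 + ε) *
      A (x - h, x - h - h) + ENNReal.ofReal (1 + ε⁻¹) * B (x, x - h))) := lintegral_mono key
    _ = escapeMass Ω f h + (ENNReal.ofReal (1 + ε) * escapeMass Ω f h +
        ENNReal.ofReal (1 + ε⁻¹) * ∫⁻ x, B (x, x - h)) := by
      rw [lintegral_add_left (by fun_prop), lintegral_add_left (by fun_prop),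
        lintegral_const_mul _ (by fun_prop), lintegral_const_mul _ (by fun_prop),
        lintegral_sub_right_eq_self (fun x => A (x, x - h)) h]
      rfl
    _ = _ := by
      have e : ENNReal.ofReal (2 + ε) = 1 + ENNReal.ofReal (1 + ε) := by
        rw [← ENNReal.ofReal_one, ← ENNReal.ofReal_add one_pos.le (by positivity)]
        congr 1; ring
      rw [← add_assoc, e, add_mul, one_mul]

theorem lintegral_kern_mul_escapeMass_le {n : ℕ} {σ : ℝ} {Ω : Set (𝔼 n)} (hΩ : MeasurableSet Ω)
    {f : (𝔼 n) → ℝ} (hf : Measurable f) {ε : ℝ} (hε : 0 < ε) (hεσ : 2 + ε < 2 ^ (2 * σ))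
    (hfin : ∫⁻ h, kern σ h * escapeMass Ω f h ≠ ∞) :
    ∫⁻ h, kern σ h * escapeMass Ω f h ≤
      ENNReal.ofReal ((1 + ε⁻¹) / (2 ^ (2 * σ) - (2 + ε))) * regionalEnergy σ Ω f := by
  have hk := measurable_kern (n := n) σ
  have hm := measurable_escapeMass hΩ hf
  -- In `ℝ≥0∞` one has `0 * ∞ = 0`, so the case of infinite energy needs the constant to be
  -- positive.
  by_cases hI : regionalEnergy σ Ω f = ∞
  · rw [hI, ENNReal.mul_top]
    · exact le_top
    · rw [ne_eq, ENNReal.ofReal_eq_zero, not_le]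
      have : 0 < 2 ^ (2 * σ) - (2 + ε) := by linarith
      positivity
  have m2 : Measurable ((Ω ×ˢ Ω).indicator
      (fun p : (𝔼 n) × (𝔼 n) => ENNReal.ofReal ((f p.1 - f p.2) ^ 2))) :=
    Measurable.indicator (by fun_prop) (hΩ.prod hΩ)
  set M := ∫⁻ h, kern σ h * escapeMass Ω f h with hM
  have h1 : ENNReal.ofReal (2 ^ (2 * σ)) * M ≤ ENNReal.ofReal (2 + ε) * M +
      ENNReal.ofReal (1 + ε⁻¹) * regionalEnergy σ Ω f := by
    rw [hM, ← lintegral_kern_mul_comp_smul σ two_pos hm, regionalEnergy_eq_translates σ hΩ hf,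
      ← lintegral_const_mul _ (by fun_prop), ← lintegral_const_mul' _ _ ENNReal.ofReal_ne_top,
      ← lintegral_add_left (by fun_prop)]
    refine lintegral_mono fun h => ?_
    calc _ ≤ kern σ h * _ := mul_le_mul_right (escapeMass_two_smul_le hΩ hf hε h) _
      _ = _ := by ring
  -- Finiteness of `M` is what permits subtracting `(2 + ε) M` from `2^{2σ} M`.
  lift M to NNReal using hfin with M' hM'
  lift regionalEnergy σ Ω f to NNReal using hI with I hI'
  rw [← ENNReal.ofReal_coe_nnreal, ← ENNReal.ofReal_coe_nnreal (p := I)] at h1 ⊢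
  have : 0 < 2 ^ (2 * σ) - (2 + ε) := by linarith
  rw [← ENNReal.ofReal_mul (by positivity), ← ENNReal.ofReal_mul (by positivity),
    ← ENNReal.ofReal_mul (by positivity), ← ENNReal.ofReal_add (by positivity) (by positivity),
    ENNReal.ofReal_le_ofReal_iff (by positivity)] at h1
  rw [← ENNReal.ofReal_mul (by positivity)]
  apply ENNReal.ofReal_le_ofReal
  rw [div_mul_eq_mul_div, le_div_iff₀ this]
  linarith

theorem lintegral_kern_compl_ball_lt_top {n : ℕ} {σ : ℝ} (hσ : 0 < σ) {δ : ℝ} (hδ : 0 < δ) :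
    ∫⁻ h in {h : 𝔼 n | δ ≤ ‖h‖}, kern σ h < ∞ := by
  have hint : Integrable (fun h : 𝔼 n => (1 + ‖h‖) ^ (-((n : ℝ) + 2 * σ))) :=
    integrable_one_add_norm (by rw [finrank_euclideanSpace_fin]; linarith)
  -- For `‖h‖ ≥ δ` one has `1 + ‖h‖ ≤ (δ⁻¹ + 1) ‖h‖`.
  set C : ℝ := (δ⁻¹ + 1) ^ ((n : ℝ) + 2 * σ)
  have hp : 0 < (n : ℝ) + 2 * σ := by positivity
  calc ∫⁻ h in {h : 𝔼 n | δ ≤ ‖h‖}, kern σ h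
      ≤ ∫⁻ h in {h : 𝔼 n | δ ≤ ‖h‖}, ENNReal.ofReal (C * (1 + ‖h‖) ^ (-((n : ℝ) + 2 * σ))) := by
        refine setLIntegral_mono' (measurableSet_le measurable_const measurable_norm) fun h hh => ?_
        refine ENNReal.ofReal_le_ofReal ?_
        have hh : δ ≤ ‖h‖ := hh
        have hpos : 0 < ‖h‖ := hδ.trans_le hh
        rw [Real.rpow_neg (by positivity), ← div_eq_mul_inv, ← Real.div_rpow (by positivity)
          (by positivity), ← Real.inv_rpow hpos.le]
        refine Real.rpow_le_rpow (by positivity) ?_ hp.le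
        rw [le_div_iff₀ (by positivity), inv_mul_le_iff₀ hpos]
        have : 1 ≤ ‖h‖ * δ⁻¹ := by rwa [← div_eq_mul_inv, one_le_div hδ]
        linarith
    _ ≤ ∫⁻ h, ENNReal.ofReal (C * (1 + ‖h‖) ^ (-((n : ℝ) + 2 * σ))) := setLIntegral_le_lintegral _ _
    _ < ∞ := (hint.const_mul C).lintegral_lt_top

theorem lintegral_kern_mul_sq_ball_lt_top {n : ℕ} (hn : 0 < n) {σ : ℝ} (hσ : σ < 1) :
    ∫⁻ h in Metric.ball (0 : 𝔼 n) 1, kern σ h * ENNReal.ofReal (‖h‖ ^ 2) < ∞ := by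
  have : Nontrivial (𝔼 n) := by
    have : Nonempty (Fin n) := ⟨⟨0, hn⟩⟩
    infer_instance
  have hint : IntegrableOn (fun h : 𝔼 n => (‖h‖ ^ ((n : ℝ) + 2 * σ))⁻¹ * ‖h‖ ^ 2)
      (Metric.ball 0 1) volume := by
    rw [integrableOn_fun_norm_addHaar volume (f := fun r => (r ^ ((n : ℝ) + 2 * σ))⁻¹ * r ^ 2),
      finrank_euclideanSpace_fin]
    -- In polar coordinates the integrand is `r^{n-1} r^{-(n+2σ)} r² = r^{1-2σ}`, integrable at 0
    -- because `σ < 1`.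
    have h1 : IntegrableOn (fun y : ℝ => y ^ (1 - 2 * σ)) (Set.Ioo 0 1) := by
      rw [intervalIntegral.integrableOn_Ioo_rpow_iff one_pos]
      linarith
    refine h1.congr_fun (fun y hy => ?_) measurableSet_Ioo
    have hy : 0 < y := hy.1
    simp only [smul_eq_mul]
    rw [← Real.rpow_neg hy.le, ← Real.rpow_natCast, ← Real.rpow_natCast, ← Real.rpow_add hy,
      ← Real.rpow_add hy, Nat.cast_sub hn]
    congr 1; push_cast; ring
  refine lt_of_eq_of_lt ?_ hint.lintegral_lt_top
  refine lintegral_congr fun h => ?_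
  rw [ENNReal.ofReal_mul (by positivity), kern]

theorem regionalEnergy_mono_set {n : ℕ} (σ : ℝ) {Ω Ω' : Set (𝔼 n)} (h : Ω ⊆ Ω')
    (u : (𝔼 n) → ℝ) : regionalEnergy σ Ω u ≤ regionalEnergy σ Ω' u := by
  rw [regionalEnergy_eq, regionalEnergy_eq]
  exact lintegral_mono_set (Set.prod_mono h h)

theorem C1c_mono {n : ℕ} {Ω Ω' : Set (𝔼 n)} (h : Ω ⊆ Ω') : C1c Ω ⊆ C1c Ω' :=
  fun _ hφ => ⟨hφ.1, hφ.2.1, hφ.2.2.trans h⟩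

theorem C1c_continuous {n : ℕ} {Ω : Set (𝔼 n)} {φ : (𝔼 n) → ℝ} (hφ : φ ∈ C1c Ω) :
    Continuous φ := hφ.1.continuous

theorem C1c_eq_zero {n : ℕ} {Ω : Set (𝔼 n)} {φ : (𝔼 n) → ℝ} (hφ : φ ∈ C1c Ω) {x : 𝔼 n}
    (hx : x ∉ Ω) : φ x = 0 := image_eq_zero_of_notMem_tsupport fun h => hx (hφ.2.2 h)

theorem C1c_add {n : ℕ} {Ω : Set (𝔼 n)} {φ ψ : (𝔼 n) → ℝ} (hφ : φ ∈ C1c Ω) (hψ : ψ ∈ C1c Ω) :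
    φ + ψ ∈ C1c Ω :=
  ⟨hφ.1.add hψ.1, hφ.2.1.add hψ.2.1,
    (tsupport_add φ ψ).trans (Set.union_subset hφ.2.2 hψ.2.2)⟩

theorem C1c_smul {n : ℕ} {Ω : Set (𝔼 n)} {φ : (𝔼 n) → ℝ} (hφ : φ ∈ C1c Ω) (c : ℝ) :
    c • φ ∈ C1c Ω :=
  ⟨contDiff_const.smul hφ.1, hφ.2.1.smul_left (f := fun _ => c),
    (closure_mono (Function.support_const_smul_subset c φ)).trans hφ.2.2⟩

theorem C1c_memLp {n : ℕ} {Ω : Set (𝔼 n)} {φ : (𝔼 n) → ℝ} (hφ : φ ∈ C1c Ω) :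
    MemLp φ 2 volume := hφ.1.continuous.memLp_of_hasCompactSupport hφ.2.1

theorem lintegral_sq_lt_top {n : ℕ} {Ω : Set (𝔼 n)} {φ : (𝔼 n) → ℝ} (hφ : φ ∈ C1c Ω) :
    ∫⁻ x, ENNReal.ofReal (φ x ^ 2) < ∞ :=
  (C1c_memLp hφ).integrable_sq.lintegral_lt_top

/-- The support of `φ` has a positive distance `δ` to the complement of `Ω`, so no mass escapes for
`‖h‖ < δ`, and for larger `h` the kernel is integrable. This a priori finiteness justifies the
absorption; its size, which depends on `φ`, does not enter the constant. -/
theorem lintegral_kern_mul_escapeMass_ne_top {n : ℕ} {σ : ℝ} (hσ : 0 < σ) {Ω : Set (𝔼 n)}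
    (hΩ : IsOpen Ω) {φ : (𝔼 n) → ℝ} (hφ : φ ∈ C1c Ω) :
    ∫⁻ h, kern σ h * escapeMass Ω φ h ≠ ∞ := by
  obtain ⟨δ, hδ, hsub⟩ := IsCompact.exists_thickening_subset_open (hφ.2.1 : IsCompact (tsupport φ)) hΩ hφ.2.2
  have hk := measurable_kern (n := n) σ
  have h1 : ∀ h : 𝔼 n, kern σ h * escapeMass Ω φ h ≤ {h : 𝔼 n | δ ≤ ‖h‖}.indicator
      (fun h => kern σ h * ∫⁻ x, ENNReal.ofReal (φ x ^ 2)) h := by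
    intro h
    by_cases hh : δ ≤ ‖h‖
    · rw [Set.indicator_of_mem (show h ∈ {h : 𝔼 n | δ ≤ ‖h‖} from hh)]
      refine mul_le_mul_right (lintegral_mono fun x => ?_) _
      exact Set.indicator_le_self' (f := fun p : (𝔼 n) × (𝔼 n) => ENNReal.ofReal (φ p.1 ^ 2))
        (fun _ _ => zero_le) (x, x - h)
    · have : escapeMass Ω φ h = 0 := by
        rw [escapeMass, lintegral_eq_zero_iff']
        · refine Eventually.of_forall fun x => ?_
          by_cases hx : x ∈ tsupport φ
          · refine Set.indicator_of_notMem ?_ _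
            have : x - h ∈ Ω := hsub (Metric.mem_thickening_iff.2 ⟨x, hx, by
              simpa [dist_eq_norm] using hh⟩)
            simp [this]
          · have : φ x = 0 := image_eq_zero_of_notMem_tsupport hx
            by_cases hp : (x, x - h) ∈ Ω ×ˢ Ωᶜ <;> simp [hp, this]
        · have h : Measurable ((Ω ×ˢ Ωᶜ).indicator
              (fun p : (𝔼 n) × (𝔼 n) => ENNReal.ofReal (φ p.1 ^ 2))) :=
            have := (C1c_continuous hφ).measurable
            Measurable.indicator (by fun_prop) (hΩ.measurableSet.prod hΩ.measurableSet.compl)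
          exact (h.comp (by fun_prop)).aemeasurable
      rw [this, mul_zero]; exact zero_le
  refine ((lintegral_mono h1).trans_lt ?_).ne
  rw [lintegral_indicator (measurableSet_le measurable_const measurable_norm),
    lintegral_mul_const _ hk]
  exact ENNReal.mul_lt_top (lintegral_kern_compl_ball_lt_top hσ hδ) (lintegral_sq_lt_top hφ)

/-- A pair with exactly one point in `Ω` contributes `φ²` at that point. The two orders of such a
pair are exchanged by `h ↦ -h`, which gives the factor 2. -/
theorem regionalEnergy_univ_le_add_escapeMass {n : ℕ} (σ : ℝ) {Ω : Set (𝔼 n)}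
    (hΩ : IsOpen Ω) {φ : (𝔼 n) → ℝ} (hφ : φ ∈ C1c Ω) :
    regionalEnergy σ Set.univ φ ≤
      regionalEnergy σ Ω φ + 2 * ∫⁻ h, kern σ h * escapeMass Ω φ h := by
  have hk := measurable_kern (n := n) σ
  have hf := (C1c_continuous hφ).measurable
  have hm := measurable_escapeMass hΩ.measurableSet hf
  have m1 : Measurable ((Ω ×ˢ Ωᶜ).indicator (fun p : (𝔼 n) × (𝔼 n) => ENNReal.ofReal (φ p.1 ^ 2))) :=
    Measurable.indicator (by fun_prop) (hΩ.measurableSet.prod hΩ.measurableSet.compl)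
  have m2 : Measurable ((Ω ×ˢ Ω).indicator
      (fun p : (𝔼 n) × (𝔼 n) => ENNReal.ofReal ((φ p.1 - φ p.2) ^ 2))) :=
    Measurable.indicator (by fun_prop) (hΩ.measurableSet.prod hΩ.measurableSet)
  set A := (Ω ×ˢ Ωᶜ).indicator (fun p : (𝔼 n) × (𝔼 n) => ENNReal.ofReal (φ p.1 ^ 2))
  set B := (Ω ×ˢ Ω).indicator
      (fun p : (𝔼 n) × (𝔼 n) => ENNReal.ofReal ((φ p.1 - φ p.2) ^ 2))
  have key : ∀ h x, ENNReal.ofReal ((φ x - φ (x - h)) ^ 2) ≤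
      B (x, x - h) + (A (x, x - h) + A (x - h, x)) := by
    intro h x
    by_cases h1 : x ∈ Ω <;> by_cases h2 : x - h ∈ Ω <;>
      simp [A, B, h1, h2, C1c_eq_zero hφ]
  have h2 : ∀ h, ∫⁻ x, A (x - h, x) = escapeMass Ω φ (-h) := by
    intro h
    change _ = ∫⁻ x, A (x, x - -h)
    rw [← lintegral_sub_right_eq_self (fun x => A (x, x - -h)) h]
    simp
  have h3 : ∫⁻ h, kern σ h * escapeMass Ω φ (-h) = ∫⁻ h, kern σ h * escapeMass Ω φ h := by
    rw [← lintegral_neg_eq_self (μ := volume) (fun h => kern σ h * escapeMass Ω φ h)]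
    simp [kern_neg]
  have hA' : Measurable fun h : 𝔼 n => ∫⁻ x, B (x, x - h) := by
    have : Measurable (Function.uncurry fun (h x : 𝔼 n) => B (x, x - h)) := m2.comp (by fun_prop)
    exact this.lintegral_prod_right
  calc regionalEnergy σ Set.univ φ
      ≤ ∫⁻ h, (kern σ h * (∫⁻ x, B (x, x - h)) + (kern σ h * escapeMass Ω φ h +
          kern σ h * escapeMass Ω φ (-h))) := by
        rw [regionalEnergy_univ_eq_translates σ hf]
        refine lintegral_mono fun h => ?_
        rw [← mul_add, ← mul_add, ← h2 h,
          show escapeMass Ω φ h = ∫⁻ x, A (x, x - h) from rfl, ← lintegral_add_left (by fun_prop),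
          ← lintegral_add_left (by fun_prop)]
        exact mul_le_mul_right (lintegral_mono (key h)) _
    _ = _ := by
      rw [lintegral_add_left (by fun_prop), lintegral_add_left (by fun_prop), h3, ← two_mul,
        regionalEnergy_eq_translates σ hΩ.measurableSet hf]

/-- Fractional Hardy inequality: for `σ > 1/2` the regional energy of a test function controls
its energy on the whole space. -/
theorem exists_regionalEnergy_univ_le {σ : ℝ} (hσ : 1 / 2 < σ) :
    ∃ C : ℝ≥0∞, C ≠ ∞ ∧ ∀ {n : ℕ} {Ω : Set (𝔼 n)}, IsOpen Ω → ∀ φ ∈ C1c Ω,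
      regionalEnergy σ Set.univ φ ≤ C * regionalEnergy σ Ω φ := by
  have h2 : (2 : ℝ) < 2 ^ (2 * σ) := by
    conv_lhs => rw [← Real.rpow_one 2]
    exact Real.rpow_lt_rpow_of_exponent_lt one_lt_two (by linarith)
  obtain ⟨ε, hε, hε'⟩ : ∃ ε : ℝ, 0 < ε ∧ 2 + ε < 2 ^ (2 * σ) :=
    ⟨(2 ^ (2 * σ) - 2) / 2, by linarith, by linarith⟩
  refine ⟨1 + 2 * ENNReal.ofReal ((1 + ε⁻¹) / (2 ^ (2 * σ) - (2 + ε))), ?_, ?_⟩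
  · finiteness
  · intro n Ω hΩ φ hφ
    refine (regionalEnergy_univ_le_add_escapeMass σ hΩ hφ).trans ?_
    rw [add_mul, one_mul, mul_assoc]
    gcongr
    exact lintegral_kern_mul_escapeMass_le hΩ.measurableSet (C1c_continuous hφ).measurable hε hε'
      (lintegral_kern_mul_escapeMass_ne_top (by linarith) hΩ hφ)

/-- Near the diagonal the Lipschitz bound supplies a factor `‖h‖²`, enough since `σ < 1`; away from
it the kernel is integrable and the `L²` norm suffices. -/
theorem regionalEnergy_univ_lt_top {n : ℕ} (hn : 0 < n) {σ : ℝ} (hσ : 0 < σ) (hσ' : σ < 1)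
    {Ω : Set (𝔼 n)} {φ : (𝔼 n) → ℝ} (hφ : φ ∈ C1c Ω) :
    regionalEnergy σ Set.univ φ < ∞ := by
  have hk := measurable_kern (n := n) σ
  obtain ⟨L, hL⟩ := hφ.1.lipschitzWith_of_hasCompactSupport hφ.2.1 one_ne_zero
  set K := tsupport φ
  have hK : volume K < ∞ := (hφ.2.1 : IsCompact K).measure_lt_top
  have hKm : MeasurableSet K := (isClosed_tsupport φ).measurableSet
  rw [regionalEnergy_univ_eq_translates σ (C1c_continuous hφ).measurable,
    ← lintegral_add_compl _ (measurableSet_ball (x := (0 : 𝔼 n)) (ε := 1))]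
  refine ENNReal.add_lt_top.2 ⟨?_, ?_⟩
  · have h1 : ∀ h : 𝔼 n, ∫⁻ x, ENNReal.ofReal ((φ x - φ (x - h)) ^ 2) ≤
        ENNReal.ofReal (‖h‖ ^ 2) * (ENNReal.ofReal (L ^ 2) * (2 * volume K)) := by
      intro h
      have h2 : ∀ x, ENNReal.ofReal ((φ x - φ (x - h)) ^ 2) ≤
          ENNReal.ofReal (‖h‖ ^ 2) * ENNReal.ofReal (L ^ 2) *
            (K.indicator 1 x + K.indicator 1 (x - h)) := by
        intro x
        by_cases hx : x ∈ K ∨ x - h ∈ K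
        · have h3 : (1 : ℝ≥0∞) ≤ K.indicator 1 x + K.indicator 1 (x - h) := by
            rcases hx with hx | hx
            · simp [hx]
            · simp [hx]
          refine le_trans ?_ (le_mul_of_one_le_right' h3)
          rw [← ENNReal.ofReal_mul (by positivity), ← mul_pow, mul_comm]
          refine ENNReal.ofReal_le_ofReal (sq_le_sq' ?_ ?_)
          · have h4 := hL.dist_le_mul x (x - h)
            rw [dist_eq_norm, dist_eq_norm, sub_sub_cancel, Real.norm_eq_abs] at h4
            exact (abs_le.1 h4).1
          · have h4 := hL.dist_le_mul x (x - h)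
            rw [dist_eq_norm, dist_eq_norm, sub_sub_cancel, Real.norm_eq_abs] at h4
            exact (abs_le.1 h4).2
        · push Not at hx
          simp [image_eq_zero_of_notMem_tsupport hx.1, image_eq_zero_of_notMem_tsupport hx.2]
      refine (lintegral_mono h2).trans_eq ?_
      have hi : Measurable (K.indicator (1 : (𝔼 n) → ℝ≥0∞)) := measurable_one.indicator hKm
      rw [lintegral_const_mul _ (by fun_prop), lintegral_add_left hi,
        lintegral_sub_right_eq_self (K.indicator (1 : (𝔼 n) → ℝ≥0∞)) h,
        lintegral_indicator_one hKm]
      ring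
    refine (lintegral_mono fun h => mul_le_mul_right (h1 h) _).trans_lt ?_
    simp only [← mul_assoc]
    rw [lintegral_mul_const _ (by fun_prop), lintegral_mul_const _ (by fun_prop),
      lintegral_mul_const _ (by fun_prop)]
    have := lintegral_kern_mul_sq_ball_lt_top hn hσ'
    finiteness
  · have h1 : ∀ h : 𝔼 n, ∫⁻ x, ENNReal.ofReal ((φ x - φ (x - h)) ^ 2) ≤
        4 * ∫⁻ x, ENNReal.ofReal (φ x ^ 2) := by
      intro h
      have hm := (C1c_continuous hφ).measurable
      have h2 : ∀ x, ENNReal.ofReal ((φ x - φ (x - h)) ^ 2) ≤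
          2 * ENNReal.ofReal (φ x ^ 2) + 2 * ENNReal.ofReal (φ (x - h) ^ 2) := by
        intro x
        have h3 : (φ x - φ (x - h)) ^ 2 ≤ 2 * φ x ^ 2 + 2 * φ (x - h) ^ 2 := by
          nlinarith [sq_nonneg (φ x + φ (x - h))]
        refine (ENNReal.ofReal_le_ofReal h3).trans_eq ?_
        rw [ENNReal.ofReal_add (by positivity) (by positivity), ENNReal.ofReal_mul zero_le_two,
          ENNReal.ofReal_mul zero_le_two, ENNReal.ofReal_ofNat]
      refine (lintegral_mono h2).trans_eq ?_
      rw [lintegral_add_left (by fun_prop), lintegral_const_mul _ (by fun_prop),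
        lintegral_const_mul _ (by fun_prop),
        lintegral_sub_right_eq_self (fun x => ENNReal.ofReal (φ x ^ 2)) h]
      ring
    refine (lintegral_mono fun h => mul_le_mul_right (h1 h) _).trans_lt ?_
    rw [lintegral_mul_const _ (by fun_prop)]
    have e : (Metric.ball (0 : 𝔼 n) 1)ᶜ = {h | 1 ≤ ‖h‖} := by ext; simp
    rw [e]
    have := lintegral_kern_compl_ball_lt_top (n := n) hσ one_pos
    have := lintegral_sq_lt_top hφ
    finiteness

/-! ### Compactness in `L²` from energy bounds -/

theorem eLpNorm_two_sq {α : Type*} [MeasurableSpace α] (μ : Measure α) (f : α → ℝ) :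
    eLpNorm f 2 μ ^ 2 = ∫⁻ x, ENNReal.ofReal (f x ^ 2) ∂μ := by
  rw [eLpNorm_eq_lintegral_rpow_enorm_toReal two_ne_zero ENNReal.ofNat_ne_top, ENNReal.toReal_ofNat,
    ← ENNReal.rpow_natCast, ← ENNReal.rpow_mul]
  norm_num
  refine lintegral_congr fun x => ?_
  rw [← Real.enorm_eq_ofReal (sq_nonneg _), enorm_pow]

theorem sq_integral_le_measureReal_mul {α : Type*} [MeasurableSpace α] {μ : Measure α}
    [IsFiniteMeasure μ] {g : α → ℝ} (hg : MemLp g 2 μ) :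
    (∫ x, g x ∂μ) ^ 2 ≤ μ.real Set.univ * ∫ x, g x ^ 2 ∂μ := by
  have hg1 : Integrable g μ := hg.integrable one_le_two
  have hg2 := hg.integrable_sq
  rcases eq_or_ne (μ.real Set.univ) 0 with h0 | h0
  · have : μ = 0 := by
      rwa [measureReal_eq_zero_iff, Measure.measure_univ_eq_zero] at h0
    simp [this]
  have hpos : 0 < μ.real Set.univ := lt_of_le_of_ne measureReal_nonneg h0.symm
  set V := μ.real Set.univ
  set S := ∫ x, g x ∂μ
  have h1 : 0 ≤ ∫ x, (g x - S / V) ^ 2 ∂μ := integral_nonneg fun x => sq_nonneg _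
  have h2 : ∫ x, (g x - S / V) ^ 2 ∂μ = ∫ x, g x ^ 2 ∂μ - S ^ 2 / V := by
    have : ∀ x, (g x - S / V) ^ 2 = g x ^ 2 - 2 * (S / V) * g x + (S / V) ^ 2 := fun x => by ring
    simp only [this]
    rw [integral_add (f := fun x => g x ^ 2 - 2 * (S / V) * g x) (hg2.sub (hg1.const_mul _))
      (integrable_const _), integral_sub hg2 (hg1.const_mul _), integral_const_mul, integral_const]
    change _ - 2 * (S / V) * S + V • (S / V) ^ 2 = _
    rw [smul_eq_mul]
    field_simp; ring
  rw [h2, sub_nonneg, div_le_iff₀ hpos] at h1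
  linarith

theorem memLp_restrict_ball {n : ℕ} {f : (𝔼 n) → ℝ} (hf : Continuous f) (c : 𝔼 n) (ε : ℝ) :
    MemLp f 2 (volume.restrict (Metric.ball c ε)) := by
  obtain ⟨B, hB⟩ := (isCompact_closedBall c ε).exists_bound_of_continuousOn hf.continuousOn
  have : IsFiniteMeasure (volume.restrict (Metric.ball c ε)) :=
    isFiniteMeasure_restrict.2 measure_ball_lt_top.ne
  refine MemLp.of_bound hf.aestronglyMeasurable B ?_
  refine (ae_restrict_iff' measurableSet_ball).2 (Eventually.of_forall fun x hx => ?_)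
  exact hB x (Metric.ball_subset_closedBall hx)

/-- A pointwise Poincaré inequality: `f x` is compared with the mean of `f` over a ball containing
`x`, the difference is bounded by Cauchy-Schwarz, and the kernel is at least `(2ε)^{-(n+2σ)}`
because two points of the ball are less than `2ε` apart. -/
theorem ofReal_sq_mul_volume_ball_le {n : ℕ} {σ : ℝ} (hσ : 0 < σ) {f : (𝔼 n) → ℝ}
    (hf : Continuous f) {x c : 𝔼 n} {ε : ℝ} (hε : 0 < ε) (hx : x ∈ Metric.ball c ε) :
    ENNReal.ofReal (f x ^ 2) * volume (Metric.ball c ε) ≤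
      ENNReal.ofReal (2 * (2 * ε) ^ ((n : ℝ) + 2 * σ)) *
        (∫⁻ y, ENNReal.ofReal ((f x - f y) ^ 2) * kern σ (x - y)) +
      2 * ENNReal.ofReal ((∫ y in Metric.ball c ε, f y) ^ 2) / volume (Metric.ball c ε) := by
  set B := Metric.ball c ε
  have hV0 : volume B ≠ 0 := (Metric.measure_ball_pos volume c hε).ne'
  have hVt : volume B ≠ ∞ := measure_ball_lt_top.ne
  have : IsFiniteMeasure (volume.restrict B) := isFiniteMeasure_restrict.2 hVt
  set V := volume.real B with hV
  have hVpos : 0 < V := ENNReal.toReal_pos hV0 hVt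
  have hVe : volume B = ENNReal.ofReal V := by rw [hV, ofReal_measureReal hVt]
  have hg : MemLp (fun y => f x - f y) 2 (volume.restrict B) :=
    memLp_restrict_ball (by fun_prop) c ε
  have hf1 : Integrable f (volume.restrict B) :=
    (memLp_restrict_ball hf c ε).integrable one_le_two
  have h1 := sq_integral_le_measureReal_mul hg
  rw [integral_sub (integrable_const _) hf1, integral_const, measureReal_restrict_apply_univ,
    ← hV, smul_eq_mul] at h1
  set S := ∫ y in B, f y
  set J := ∫ y in B, (f x - f y) ^ 2 with hJ
  have h2 : f x ^ 2 * V ≤ 2 * J + 2 * S ^ 2 / V := by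
    have h3 : (V * f x) ^ 2 ≤ 2 * (V * f x - S) ^ 2 + 2 * S ^ 2 := by
      nlinarith [sq_nonneg (V * f x - 2 * S)]
    have h4 : V * (f x ^ 2 * V) ≤ V * (2 * J + 2 * S ^ 2 / V) := by
      have : V * (2 * J + 2 * S ^ 2 / V) = 2 * (V * J) + 2 * S ^ 2 := by field_simp
      rw [this]; nlinarith
    exact le_of_mul_le_mul_left h4 hVpos
  have hJ0 : 0 ≤ J := integral_nonneg fun y => sq_nonneg _
  have h5 : ENNReal.ofReal J ≤ ENNReal.ofReal ((2 * ε) ^ ((n : ℝ) + 2 * σ)) *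
      ∫⁻ y, ENNReal.ofReal ((f x - f y) ^ 2) * kern σ (x - y) := by
    rw [hJ, ofReal_integral_eq_lintegral_ofReal hg.integrable_sq
      (Eventually.of_forall fun y => sq_nonneg _),
      ← lintegral_const_mul' _ _ ENNReal.ofReal_ne_top]
    refine (setLIntegral_mono' measurableSet_ball fun y hy => ?_).trans
      (setLIntegral_le_lintegral B _)
    rw [mul_left_comm, kern, ← ENNReal.ofReal_mul (by positivity)]
    rcases eq_or_ne x y with rfl | hxy
    · simp
    refine le_mul_of_one_le_right' ?_
    rw [ENNReal.one_le_ofReal]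
    have hpos : 0 < ‖x - y‖ := norm_pos_iff.2 (sub_ne_zero.2 hxy)
    rw [← Real.inv_rpow hpos.le, ← Real.mul_rpow (by positivity) (by positivity)]
    refine Real.one_le_rpow ?_ (by positivity)
    rw [← div_eq_mul_inv, one_le_div hpos, ← dist_eq_norm]
    have := dist_triangle_right x y c
    have h6 : dist x c < ε := hx
    have h7 : dist y c < ε := hy
    linarith
  calc ENNReal.ofReal (f x ^ 2) * volume B = ENNReal.ofReal (f x ^ 2 * V) := by
        rw [hVe, ENNReal.ofReal_mul (sq_nonneg _)]
    _ ≤ ENNReal.ofReal (2 * J + 2 * S ^ 2 / V) := ENNReal.ofReal_le_ofReal h2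
    _ = 2 * ENNReal.ofReal J + 2 * ENNReal.ofReal (S ^ 2) / volume B := by
        rw [ENNReal.ofReal_add (by positivity) (by positivity), ENNReal.ofReal_div_of_pos hVpos,
          ENNReal.ofReal_mul zero_le_two, ENNReal.ofReal_mul zero_le_two, ENNReal.ofReal_ofNat, hVe]
    _ ≤ _ := by
        rw [ENNReal.ofReal_mul zero_le_two, ENNReal.ofReal_ofNat, mul_assoc]
        gcongr

theorem lintegral_sq_le_add_sum {n : ℕ} {σ : ℝ} (hσ : 0 < σ) {K : Set (𝔼 n)}
    {t : Finset (𝔼 n)} {ε : ℝ} (hε : 0 < ε) (hK : K ⊆ ⋃ c ∈ t, Metric.ball c ε)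
    {f : (𝔼 n) → ℝ} (hf : Continuous f) (hfK : ∀ x ∉ K, f x = 0) :
    ∫⁻ x, ENNReal.ofReal (f x ^ 2) ≤
      ENNReal.ofReal (2 * (2 * ε) ^ ((n : ℝ) + 2 * σ)) / volume (Metric.ball (0 : 𝔼 n) ε) *
        regionalEnergy σ Set.univ f +
      (2 * volume K / volume (Metric.ball (0 : 𝔼 n) ε) ^ 2) *
        ∑ c ∈ t, ENNReal.ofReal ((∫ y in Metric.ball c ε, f y) ^ 2) := by
  have hk := measurable_kern (n := n) σ
  set V := volume (Metric.ball (0 : 𝔼 n) ε)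
  have hV0 : V ≠ 0 := (Metric.measure_ball_pos volume _ hε).ne'
  have hVt : V ≠ ∞ := measure_ball_lt_top.ne
  set A := ENNReal.ofReal (2 * (2 * ε) ^ ((n : ℝ) + 2 * σ))
  set T0 := ∑ c ∈ t, ENNReal.ofReal ((∫ y in Metric.ball c ε, f y) ^ 2)
  have hm := hf.measurable
  have key : ∀ x, ENNReal.ofReal (f x ^ 2) ≤
      A / V * (∫⁻ y, ENNReal.ofReal ((f x - f y) ^ 2) * kern σ (x - y)) +
      K.indicator (fun _ => 2 * T0 / V ^ 2) x := by
    intro x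
    by_cases hx : x ∈ K
    · obtain ⟨c, hc, hxc⟩ : ∃ c ∈ t, x ∈ Metric.ball c ε := by simpa using hK hx
      have h1 := ofReal_sq_mul_volume_ball_le hσ hf hε hxc
      have hB : volume (Metric.ball c ε) = V := Measure.addHaar_ball_center _ _ _
      rw [hB, ← ENNReal.le_div_iff_mul_le (Or.inl hV0) (Or.inl hVt), ENNReal.add_div] at h1
      simp only [div_eq_mul_inv] at h1
      rw [Set.indicator_of_mem hx, div_eq_mul_inv _ (V ^ 2), ENNReal.inv_pow, div_eq_mul_inv, sq V⁻¹]
      refine h1.trans ?_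
      rw [mul_right_comm, mul_assoc _ V⁻¹ V⁻¹]
      gcongr
      exact Finset.single_le_sum (f := fun c => ENNReal.ofReal ((∫ y in Metric.ball c ε, f y) ^ 2))
        (fun _ _ => zero_le) hc
    · simp [hfK x hx]
  have hm2 : Measurable fun x : 𝔼 n =>
      ∫⁻ y, ENNReal.ofReal ((f x - f y) ^ 2) * kern σ (x - y) := by
    have : Measurable (Function.uncurry fun x y : 𝔼 n =>
      ENNReal.ofReal ((f x - f y) ^ 2) * kern σ (x - y)) := by
        unfold Function.uncurry; fun_prop
    exact this.lintegral_prod_right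
  refine (lintegral_mono key).trans ?_
  rw [lintegral_add_left (by fun_prop), lintegral_const_mul _ hm2, regionalEnergy_eq,
    Set.univ_prod_univ, setLIntegral_univ, lintegral_prod _ (by fun_prop)]
  refine add_le_add le_rfl ((lintegral_indicator_const_le _ _).trans_eq ?_)
  simp only [div_eq_mul_inv]; ring

/-- The volume of the ball is of order `ε^n`, so the quotient is a constant times `ε^{2σ}`. This
smallness serves both the compactness in `L²` and the exclusion of thin domains. -/
theorem tendsto_ball_coeff {n : ℕ} {σ : ℝ} (hσ : 0 < σ) :
    Tendsto (fun ε : ℝ => ENNReal.ofReal (2 * (2 * ε) ^ ((n : ℝ) + 2 * σ)) /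
      volume (Metric.ball (0 : 𝔼 n) ε)) (𝓝[>] 0) (𝓝 0) := by
  set V := volume (Metric.ball (0 : 𝔼 n) 1)
  have hV0 : V ≠ 0 := (Metric.measure_ball_pos volume _ one_pos).ne'
  have h1 : ∀ ε ∈ Set.Ioi (0 : ℝ), ENNReal.ofReal (2 * 2 ^ ((n : ℝ) + 2 * σ) * ε ^ (2 * σ)) / V =
      ENNReal.ofReal (2 * (2 * ε) ^ ((n : ℝ) + 2 * σ)) / volume (Metric.ball (0 : 𝔼 n) ε) := by
    intro ε hε
    have hε : 0 < ε := hε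
    have hv : 0 < V.toReal := ENNReal.toReal_pos hV0 measure_ball_lt_top.ne
    have hVe : V = ENNReal.ofReal V.toReal := (ENNReal.ofReal_toReal measure_ball_lt_top.ne).symm
    rw [Measure.addHaar_ball_of_pos _ _ hε, finrank_euclideanSpace_fin]
    change _ = _ / (_ * V)
    set v := V.toReal
    rw [hVe,
      ← ENNReal.ofReal_mul (by positivity), ← ENNReal.ofReal_div_of_pos hv,
      ← ENNReal.ofReal_div_of_pos (by positivity), Real.mul_rpow zero_le_two hε.le,
      Real.rpow_add hε, Real.rpow_natCast]
    congr 1; field_simp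
  refine Tendsto.congr' (eventually_nhdsWithin_of_forall h1) ?_
  have h2 : Tendsto (fun ε : ℝ => ENNReal.ofReal (2 * 2 ^ ((n : ℝ) + 2 * σ) * ε ^ (2 * σ)))
      (𝓝[>] 0) (𝓝 0) := by
    have : Tendsto (fun ε : ℝ => 2 * 2 ^ ((n : ℝ) + 2 * σ) * ε ^ (2 * σ)) (𝓝 0) (𝓝 0) := by
      have h := ((Real.continuousAt_rpow_const 0 (2 * σ) (Or.inr (by linarith))).tendsto).const_mul
        (2 * 2 ^ ((n : ℝ) + 2 * σ))
      rwa [Real.zero_rpow (by linarith), mul_zero] at h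
    have := (ENNReal.continuous_ofReal.tendsto 0).comp this
    rw [ENNReal.ofReal_zero] at this
    exact this.mono_left nhdsWithin_le_nhds
  simpa using ENNReal.Tendsto.div_const h2 (Or.inr hV0)

/-- An Ehrling-type inequality: up to a small multiple of the energy, the `L²` norm is controlled by
finitely many linear functionals, so precompactness reduces to convergence of countably many
numbers. -/
theorem exists_lintegral_sq_le {n : ℕ} {σ : ℝ} (hσ : 0 < σ) {K : Set (𝔼 n)} (hK : IsCompact K)
    {η : ℝ≥0∞} (hη : 0 < η) :
    ∃ (t : Finset (𝔼 n)) (ε : ℝ) (C : ℝ≥0∞), C ≠ ∞ ∧ ∀ f : (𝔼 n) → ℝ, Continuous f →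
      (∀ x ∉ K, f x = 0) → ∫⁻ x, ENNReal.ofReal (f x ^ 2) ≤
        η * regionalEnergy σ Set.univ f +
          C * ∑ c ∈ t, ENNReal.ofReal ((∫ y in Metric.ball c ε, f y) ^ 2) := by
  obtain ⟨ε, hε, hε0⟩ := (((tendsto_ball_coeff (n := n) hσ).eventually (gt_mem_nhds hη)).and
    self_mem_nhdsWithin).exists
  have hε0 : 0 < ε := hε0
  obtain ⟨t, -, htf, ht⟩ := hK.finite_cover_balls hε0
  refine ⟨htf.toFinset, ε, 2 * volume K / volume (Metric.ball (0 : 𝔼 n) ε) ^ 2, ?_,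
    fun f hf hfK => ?_⟩
  · exact ENNReal.div_ne_top (ENNReal.mul_ne_top ENNReal.ofNat_ne_top hK.measure_lt_top.ne)
      (pow_ne_zero 2 (Metric.measure_ball_pos volume _ hε0).ne')
  · refine (lintegral_sq_le_add_sum hσ hε0 (K := K) (t := htf.toFinset) (by simpa using ht) hf hfK).trans ?_
    gcongr

theorem regionalEnergy_sub_le {n : ℕ} (σ : ℝ) (Ω : Set (𝔼 n)) {f g : (𝔼 n) → ℝ}
    (hf : Measurable f) (hg : Measurable g) :
    regionalEnergy σ Ω (f - g) ≤ 2 * regionalEnergy σ Ω f + 2 * regionalEnergy σ Ω g := by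
  have hk := measurable_kern (n := n) σ
  simp only [regionalEnergy_eq]
  rw [← lintegral_const_mul _ (by fun_prop), ← lintegral_const_mul _ (by fun_prop),
    ← lintegral_add_left (by fun_prop)]
  refine lintegral_mono fun p => ?_
  rw [← mul_assoc, ← mul_assoc, ← add_mul]
  gcongr
  have h3 : ((f - g) p.1 - (f - g) p.2) ^ 2 ≤
      2 * (f p.1 - f p.2) ^ 2 + 2 * (g p.1 - g p.2) ^ 2 := by
    simp only [Pi.sub_apply]
    nlinarith [sq_nonneg ((f p.1 - f p.2) + (g p.1 - g p.2))]
  refine (ENNReal.ofReal_le_ofReal h3).trans_eq ?_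
  rw [ENNReal.ofReal_add (by positivity) (by positivity), ENNReal.ofReal_mul zero_le_two,
    ENNReal.ofReal_mul zero_le_two, ENNReal.ofReal_ofNat]

theorem abs_setIntegral_ball_le {n : ℕ} {f : (𝔼 n) → ℝ} (hf : Continuous f)
    (h1 : ∫⁻ x, ENNReal.ofReal (f x ^ 2) ≤ 1) (c : 𝔼 n) (ε : ℝ) :
    |∫ y in Metric.ball c ε, f y| ≤ Real.sqrt (volume.real (Metric.ball c ε)) := by
  have : IsFiniteMeasure (volume.restrict (Metric.ball c ε)) :=
    isFiniteMeasure_restrict.2 measure_ball_lt_top.ne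
  refine Real.abs_le_sqrt ((sq_integral_le_measureReal_mul (memLp_restrict_ball hf c ε)).trans ?_)
  rw [measureReal_restrict_apply_univ]
  refine mul_le_of_le_one_right measureReal_nonneg ?_
  rw [integral_eq_lintegral_of_nonneg_ae (Eventually.of_forall fun _ => sq_nonneg _)
    (by fun_prop)]
  exact ENNReal.toReal_le_of_le_ofReal zero_le_one
    (((setLIntegral_le_lintegral _ _).trans h1).trans_eq ENNReal.ofReal_one.symm)

/-- Compactness of the embedding of the fractional Sobolev space with supports in a fixed compact
set into `L²`. -/
theorem exists_subseq_tendsto_of_energy_bounded {n : ℕ} {σ : ℝ} (hσ : 0 < σ) {K : Set (𝔼 n)}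
    (hK : IsCompact K) {M : ℝ≥0∞} (hM : M ≠ ∞) {f : ℕ → (𝔼 n) → ℝ} (hf : ∀ k, Continuous (f k))
    (hfK : ∀ k, ∀ x ∉ K, f k x = 0) (h1 : ∀ k, eLpNorm (f k) 2 volume ≤ 1)
    (hI : ∀ k, regionalEnergy σ Set.univ (f k) ≤ M) :
    ∃ (φ : ℕ → ℕ) (u : (𝔼 n) → ℝ), StrictMono φ ∧ MemLp u 2 volume ∧
      Tendsto (fun k => eLpNorm (f (φ k) - u) 2 volume) atTop (𝓝 0) := by
  have h1' : ∀ k, ∫⁻ x, ENNReal.ofReal (f k x ^ 2) ≤ 1 := fun k => by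
    rw [← eLpNorm_two_sq]; exact pow_le_one₀ zero_le (h1 k)
  have hη : ∀ m : ℕ, (0 : ℝ≥0∞) < (m + 1 : ℝ≥0∞)⁻¹ := fun m => by
    simp only [ENNReal.inv_pos]; finiteness
  choose t ε C hC hest using fun m : ℕ => exists_lintegral_sq_le (n := n) hσ hK (hη m)
  -- All ball integrals, for all scales `m`, form one point of a countable product of compact
  -- intervals; Tychonoff's theorem takes the place of a diagonal argument.
  let a : ℕ → (Σ m : ℕ, t m) → ℝ := fun k i => ∫ y in Metric.ball (i.2 : 𝔼 n) (ε i.1), f k y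
  let b : (Σ m : ℕ, t m) → ℝ := fun i =>
    Real.sqrt (volume.real (Metric.ball (i.2 : 𝔼 n) (ε i.1)))
  have hcpt : IsCompact (Set.univ.pi fun i => Set.Icc (-b i) (b i)) :=
    isCompact_univ_pi fun i => isCompact_Icc
  obtain ⟨a₀, -, φ, hφ, hlim⟩ := hcpt.tendsto_subseq (x := a) fun k i _ =>
    abs_le.1 (abs_setIntegral_ball_le (hf k) (h1' k) _ _)
  have hlim' : ∀ i, Tendsto (fun k => a (φ k) i) atTop (𝓝 (a₀ i)) := tendsto_pi_nhds.1 hlim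
  have hmem : ∀ k, MemLp (f k) 2 volume := fun k =>
    ⟨(hf k).aestronglyMeasurable, (h1 k).trans_lt ENNReal.one_lt_top⟩
  have hpair : ∀ m, Tendsto (fun p : ℕ × ℕ => C m * ∑ c ∈ t m, ENNReal.ofReal
      ((∫ y in Metric.ball c (ε m), (f (φ p.1) - f (φ p.2)) y) ^ 2)) (atTop ×ˢ atTop) (𝓝 0) := by
    intro m
    rw [← mul_zero (C m)]
    refine ENNReal.Tendsto.const_mul ?_ (Or.inr (hC m))
    rw [← Finset.sum_const_zero (s := t m)]
    refine tendsto_finsetSum _ fun c hc => ?_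
    have h2 := hlim' ⟨m, c, hc⟩
    have h3 : Tendsto (fun p : ℕ × ℕ => (a (φ p.1) ⟨m, c, hc⟩ - a (φ p.2) ⟨m, c, hc⟩) ^ 2)
        (atTop ×ˢ atTop) (𝓝 0) := by
      have := ((h2.comp (tendsto_fst (g := atTop))).sub (h2.comp (tendsto_snd (f := atTop)))).pow 2
      simpa using this
    have h4 := (ENNReal.continuous_ofReal.tendsto 0).comp h3
    rw [ENNReal.ofReal_zero] at h4
    refine h4.congr fun p => ?_
    have hi : ∀ k, Integrable (f k) (volume.restrict (Metric.ball c (ε m))) := fun k =>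
      have : IsFiniteMeasure (volume.restrict (Metric.ball c (ε m))) :=
        isFiniteMeasure_restrict.2 measure_ball_lt_top.ne
      (memLp_restrict_ball (hf k) c (ε m)).integrable one_le_two
    simp only [Function.comp, Pi.sub_apply]
    rw [integral_sub (hi _) (hi _)]
  have hI2 : ∀ k l, regionalEnergy σ Set.univ (f k - f l) ≤ 4 * M := by
    intro k l
    refine (regionalEnergy_sub_le σ _ (hf k).measurable (hf l).measurable).trans ?_
    calc _ ≤ 2 * M + 2 * M := by gcongr <;> apply hI
      _ = 4 * M := by ring
  have hcau : CauchySeq fun k => (hmem (φ k)).toLp (f (φ k)) := by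
    rw [EMetric.cauchySeq_iff]
    intro δ hδ
    have hδ2 : 0 < δ ^ 2 := ENNReal.pow_pos hδ 2
    -- The scale `m` is fixed first, to make the energy term small; only then are the finitely many
    -- ball integrals at that scale made small.
    obtain ⟨m, hm⟩ : ∃ m : ℕ, (m + 1 : ℝ≥0∞)⁻¹ * (4 * M) < δ ^ 2 / 2 := by
      have h5 : Tendsto (fun m : ℕ => ((m : ℝ≥0∞) + 1)⁻¹ * (4 * M)) atTop (𝓝 0) := by
        rw [← zero_mul (4 * M)]
        refine ENNReal.Tendsto.mul_const ?_ (Or.inr (by finiteness))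
        have := (tendsto_add_atTop_iff_nat 1).2 ENNReal.tendsto_inv_nat_nhds_zero
        simpa using this
      exact (h5.eventually (gt_mem_nhds (ENNReal.half_pos hδ2.ne'))).exists
    have h6 := (hpair m).eventually (gt_mem_nhds (ENNReal.half_pos hδ2.ne'))
    rw [prod_atTop_atTop_eq, eventually_atTop_prod_self] at h6
    obtain ⟨N, hN⟩ := h6
    refine ⟨N, fun k hk l hl => ?_⟩
    rw [Lp.edist_toLp_toLp]
    refine (ENNReal.pow_lt_pow_left_iff two_ne_zero).1 ?_
    rw [eLpNorm_two_sq]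
    refine (hest m (f (φ k) - f (φ l)) ((hf _).sub (hf _)) fun x hx => ?_).trans_lt ?_
    · simp [hfK _ x hx]
    · calc _ ≤ (m + 1 : ℝ≥0∞)⁻¹ * (4 * M) + _ := by gcongr; exact hI2 _ _
        _ < δ ^ 2 / 2 + δ ^ 2 / 2 := ENNReal.add_lt_add hm (hN k l hk hl)
        _ = δ ^ 2 := ENNReal.add_halves _
  obtain ⟨U, hU⟩ := cauchySeq_tendsto_of_complete hcau
  refine ⟨φ, U, hφ, Lp.memLp U, ?_⟩
  exact (Lp.tendsto_Lp_iff_tendsto_eLpNorm'' _ (fun k => hmem (φ k)) U (Lp.memLp U)).1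
    (by simpa using hU)

/-! ### Lower semicontinuity of the energy and membership in `HRing` -/

theorem tendsto_eLpNorm_of_tendsto_eLpNorm_sub {α : Type*} [MeasurableSpace α] {μ : Measure α}
    {f : ℕ → α → ℝ} {u : α → ℝ} (hf : ∀ k, AEStronglyMeasurable (f k) μ) (hu : MemLp u 2 μ)
    (h : Tendsto (fun k => eLpNorm (f k - u) 2 μ) atTop (𝓝 0)) :
    Tendsto (fun k => eLpNorm (f k) 2 μ) atTop (𝓝 (eLpNorm u 2 μ)) := by
  have h1 : Tendsto (fun k => eLpNorm u 2 μ - eLpNorm (f k - u) 2 μ) atTop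
      (𝓝 (eLpNorm u 2 μ)) := by
    simpa using ENNReal.Tendsto.sub tendsto_const_nhds h (Or.inl hu.2.ne)
  have h2 : Tendsto (fun k => eLpNorm u 2 μ + eLpNorm (f k - u) 2 μ) atTop
      (𝓝 (eLpNorm u 2 μ)) := by
    simpa using tendsto_const_nhds.add h
  refine tendsto_of_tendsto_of_tendsto_of_le_of_le h1 h2 (fun k => ?_) fun k => ?_
  · rw [tsub_le_iff_right]
    have := eLpNorm_sub_le (hf k) ((hf k).sub hu.1) one_le_two
    rwa [sub_sub_cancel] at this
  · have := eLpNorm_add_le hu.1 ((hf k).sub hu.1) one_le_two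
    rwa [add_sub_cancel] at this

theorem regionalEnergy_const_smul {n : ℕ} (σ : ℝ) (Ω : Set (𝔼 n)) (c : ℝ) (u : (𝔼 n) → ℝ) :
    regionalEnergy σ Ω (c • u) = ENNReal.ofReal (c ^ 2) * regionalEnergy σ Ω u := by
  rw [regionalEnergy_eq, regionalEnergy_eq, ← lintegral_const_mul' _ _ ENNReal.ofReal_ne_top]
  refine lintegral_congr fun p => ?_
  rw [← mul_assoc, ← ENNReal.ofReal_mul (sq_nonneg c)]
  congr 2
  simp only [Pi.smul_apply, smul_eq_mul]; ring

theorem regionalEnergy_parallelogram {n : ℕ} (σ : ℝ) (Ω : Set (𝔼 n)) {f g : (𝔼 n) → ℝ}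
    (hf : Measurable f) (hg : Measurable g) :
    regionalEnergy σ Ω (f + g) + regionalEnergy σ Ω (f - g) =
      2 * regionalEnergy σ Ω f + 2 * regionalEnergy σ Ω g := by
  have hk := measurable_kern (n := n) σ
  simp only [regionalEnergy_eq]
  rw [← lintegral_const_mul _ (by fun_prop), ← lintegral_const_mul _ (by fun_prop),
    ← lintegral_add_left (by fun_prop), ← lintegral_add_left (by fun_prop)]
  refine lintegral_congr fun p => ?_
  rw [← mul_assoc, ← mul_assoc, ← add_mul, ← add_mul]
  congr 1
  have e : ∀ a : ℝ, 2 * ENNReal.ofReal (a ^ 2) = ENNReal.ofReal (2 * a ^ 2) := fun a => by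
    rw [ENNReal.ofReal_mul zero_le_two, ENNReal.ofReal_ofNat]
  rw [e, e, ← ENNReal.ofReal_add (by positivity) (by positivity),
    ← ENNReal.ofReal_add (by positivity) (by positivity)]
  congr 1
  simp only [Pi.add_apply, Pi.sub_apply]; ring

theorem regionalEnergy_midpoint_add {n : ℕ} (σ : ℝ) (Ω : Set (𝔼 n)) {f g : (𝔼 n) → ℝ}
    (hf : Measurable f) (hg : Measurable g) :
    4 * regionalEnergy σ Ω ((1 / 2 : ℝ) • (f + g)) + regionalEnergy σ Ω (f - g) =
      2 * regionalEnergy σ Ω f + 2 * regionalEnergy σ Ω g := by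
  rw [← regionalEnergy_parallelogram σ Ω hf hg, regionalEnergy_const_smul, ← mul_assoc,
    ← ENNReal.ofReal_ofNat 4, ← ENNReal.ofReal_mul (by norm_num)]
  norm_num

/-- Near-minimizers of the energy in a decreasing sequence of midpoint convex sets form a Cauchy
sequence for the energy. -/
theorem exists_energy_cauchySeq {n : ℕ} (σ : ℝ) (Ω : Set (𝔼 n)) {C : ℕ → Set ((𝔼 n) → ℝ)}
    (hanti : Antitone C) (hne : ∀ j, (C j).Nonempty) (hmeas : ∀ j, ∀ f ∈ C j, Measurable f)
    (hmid : ∀ j, ∀ f ∈ C j, ∀ g ∈ C j, (1 / 2 : ℝ) • (f + g) ∈ C j)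
    {M : ℝ≥0∞} (hM : M ≠ ∞) (hI : ∀ j, ∀ f ∈ C j, regionalEnergy σ Ω f ≤ M) :
    ∃ ψ : ℕ → (𝔼 n) → ℝ, (∀ j, ψ j ∈ C j) ∧
      ∀ δ > 0, ∃ N, ∀ i ≥ N, ∀ j ≥ N, regionalEnergy σ Ω (ψ i - ψ j) ≤ δ := by
  set d : ℕ → ℝ≥0∞ := fun j => ⨅ f ∈ C j, regionalEnergy σ Ω f with hd
  have hdmono : Monotone d := fun i j hij => biInf_mono fun f hf => hanti hij hf
  have hdM : ∀ j, d j ≤ M := fun j =>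
    let ⟨f, hf⟩ := hne j; (iInf₂_le f hf).trans (hI j f hf)
  have hex : ∀ j, ∃ f ∈ C j, regionalEnergy σ Ω f < d j + (j + 1 : ℝ≥0∞)⁻¹ := by
    intro j
    have : d j < d j + (j + 1 : ℝ≥0∞)⁻¹ :=
      ENNReal.lt_add_right (ne_top_of_le_ne_top hM (hdM j)) (by
        simp only [ne_eq, ENNReal.inv_eq_zero]; finiteness)
    simpa [hd, iInf_lt_iff] using this
  choose ψ hψ hψd using hex
  refine ⟨ψ, hψ, fun δ hδ => ?_⟩
  set D := ⨆ j, d j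
  have hDt : D ≠ ∞ := ne_top_of_le_ne_top hM (iSup_le hdM)
  -- For `i, j ≥ N` the midpoint lies in `C N`, so its energy is at least `d N`. The parallelogram
  -- identity then bounds the energy of the difference by `4 (D + 1/(N+1)) - 4 d N`, which tends to
  -- 0 since `d` increases to the finite limit `D`.
  have hlim : Tendsto (fun j : ℕ => 4 * (D + (j + 1 : ℝ≥0∞)⁻¹) - 4 * d j) atTop (𝓝 0) := by
    have h1 : Tendsto (fun j : ℕ => ((j : ℝ≥0∞) + 1)⁻¹) atTop (𝓝 0) := by
      have := (tendsto_add_atTop_iff_nat 1).2 ENNReal.tendsto_inv_nat_nhds_zero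
      simpa using this
    have h2 : Tendsto (fun j : ℕ => 4 * (D + (j + 1 : ℝ≥0∞)⁻¹)) atTop (𝓝 (4 * (D + 0))) :=
      ENNReal.Tendsto.const_mul (tendsto_const_nhds.add h1) (Or.inr (by finiteness))
    have h3 : Tendsto (fun j : ℕ => 4 * d j) atTop (𝓝 (4 * D)) :=
      ENNReal.Tendsto.const_mul (tendsto_atTop_iSup hdmono) (Or.inr (by finiteness))
    have := ENNReal.Tendsto.sub h2 h3 (Or.inl (by finiteness))
    simpa using this
  obtain ⟨N, hN⟩ := (hlim.eventually (ge_mem_nhds hδ)).exists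
  refine ⟨N, fun i hi j hj => le_trans ?_ hN⟩
  have hbound : ∀ i ≥ N, regionalEnergy σ Ω (ψ i) ≤ D + (N + 1 : ℝ≥0∞)⁻¹ := by
    intro i hi
    refine (hψd i).le.trans ?_
    gcongr
    exact le_iSup d i
  have hpar := regionalEnergy_midpoint_add σ Ω (hmeas i _ (hψ i)) (hmeas j _ (hψ j))
  have hmem := hmid N _ (hanti hi (hψ i)) _ (hanti hj (hψ j))
  have hdN : d N ≤ regionalEnergy σ Ω ((1 / 2 : ℝ) • (ψ i + ψ j)) := iInf₂_le _ hmem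
  refine ENNReal.le_sub_of_add_le_left (ENNReal.mul_ne_top ENNReal.ofNat_ne_top
    (ne_top_of_le_ne_top hM (hdM N))) ?_
  calc 4 * d N + regionalEnergy σ Ω (ψ i - ψ j) ≤ _ := by gcongr
    _ = _ := hpar
    _ ≤ 2 * (D + (N + 1 : ℝ≥0∞)⁻¹) + 2 * (D + (N + 1 : ℝ≥0∞)⁻¹) := by
      gcongr
      · exact hbound i hi
      · exact hbound j hj
    _ = _ := by ring

/-- Lower semicontinuity of the energy under almost everywhere convergence, along domains that
exhaust the limit domain. -/
theorem regionalEnergy_le_liminf {n : ℕ} (σ : ℝ) {Ω : Set (𝔼 n)} {U : ℕ → Set (𝔼 n)}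
    (hU : ∀ k, MeasurableSet (U k)) {v : ℕ → (𝔼 n) → ℝ} (hv : ∀ k, Measurable (v k))
    {w : (𝔼 n) → ℝ} (hlim : ∀ᵐ x ∂volume.restrict Ω, Tendsto (fun k => v k x) atTop (𝓝 (w x)))
    (hUΩ : ∀ᵐ x ∂volume.restrict Ω, ∀ᶠ k in atTop, x ∈ U k) :
    regionalEnergy σ Ω w ≤ liminf (fun k => regionalEnergy σ (U k) (v k)) atTop := by
  have hk := measurable_kern (n := n) σ
  let F : ℕ → (𝔼 n) × (𝔼 n) → ℝ≥0∞ := fun k => (U k ×ˢ U k).indicator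
    fun p => ENNReal.ofReal ((v k p.1 - v k p.2) ^ 2) * kern σ (p.1 - p.2)
  have hF : ∀ k, Measurable (F k) := fun k => by
    have := hv k
    exact Measurable.indicator (by fun_prop) ((hU k).prod (hU k))
  have h1 : ∀ᵐ p ∂prodMeasure Ω, ENNReal.ofReal ((w p.1 - w p.2) ^ 2) * kern σ (p.1 - p.2) ≤
      liminf (fun k => F k p) atTop := by
    have hx := (Measure.quasiMeasurePreserving_fst (μ := volume.restrict Ω)
      (ν := volume.restrict Ω)).ae (hlim.and hUΩ)
    have hy := (Measure.quasiMeasurePreserving_snd (μ := volume.restrict Ω)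
      (ν := volume.restrict Ω)).ae (hlim.and hUΩ)
    filter_upwards [hx, hy] with p hpx hpy
    refine (Tendsto.liminf_eq ?_).ge
    have ht : Tendsto (fun k => ENNReal.ofReal ((v k p.1 - v k p.2) ^ 2) * kern σ (p.1 - p.2))
        atTop (𝓝 (ENNReal.ofReal ((w p.1 - w p.2) ^ 2) * kern σ (p.1 - p.2))) :=
      ENNReal.Tendsto.mul_const ((ENNReal.continuous_ofReal.tendsto _).comp
        ((hpx.1.sub hpy.1).pow 2)) (Or.inr ENNReal.ofReal_ne_top)
    refine ht.congr' ?_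
    filter_upwards [hpx.2, hpy.2] with k h1 h2
    simp only [F]
    rw [Set.indicator_of_mem (show p ∈ U k ×ˢ U k from ⟨h1, h2⟩)]
  calc regionalEnergy σ Ω w ≤ ∫⁻ p, liminf (fun k => F k p) atTop ∂prodMeasure Ω := by
        simp only [regionalEnergy, ofReal_energy_integrand]
        exact lintegral_mono_ae h1
    _ ≤ liminf (fun k => ∫⁻ p, F k p ∂prodMeasure Ω) atTop := lintegral_liminf_le hF
    _ ≤ _ := by
        refine liminf_le_liminf (Eventually.of_forall fun k => ?_)
        rw [regionalEnergy_eq, ← lintegral_indicator ((hU k).prod (hU k)), prodMeasure,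
          Measure.prod_restrict]
        exact setLIntegral_le_lintegral _ _

/-- An `L²` limit of test functions with bounded energy belongs to `H̊^σ(Ω)`. -/
theorem mem_HRing_of_tendsto {n : ℕ} {σ : ℝ} {Ω : Set (𝔼 n)} (hΩ : MeasurableSet Ω)
    {u : (𝔼 n) → ℝ} (hu : MemLp u 2 (volume.restrict Ω)) {φ : ℕ → (𝔼 n) → ℝ}
    (hφ : ∀ k, φ k ∈ C1c Ω)
    (hlim : Tendsto (fun k => eLpNorm (φ k - u) 2 (volume.restrict Ω)) atTop (𝓝 0))
    {M : ℝ≥0∞} (hM : M ≠ ∞) (hI : ∀ k, regionalEnergy σ Ω (φ k) ≤ M) : u ∈ HRing σ Ω := by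
  have hCm : ∀ ψ ∈ C1c Ω, Measurable ψ := fun ψ h => (C1c_continuous h).measurable
  -- The space demands convergence in energy, but `φ` only has bounded energy. It is replaced by
  -- near-minimizers of the energy among the test functions ever closer to `u` in `L²`; these sets
  -- are stable under midpoints.
  set C : ℕ → Set ((𝔼 n) → ℝ) := fun j => {ψ | ψ ∈ C1c Ω ∧ regionalEnergy σ Ω ψ ≤ M ∧
    eLpNorm (ψ - u) 2 (volume.restrict Ω) ≤ (j + 1 : ℝ≥0∞)⁻¹}
  obtain ⟨ψ, hψ, hcau⟩ := exists_energy_cauchySeq σ Ω (C := C) (M := M)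
    (fun i j hij f hf => ⟨hf.1, hf.2.1, hf.2.2.trans (by gcongr)⟩)
    (fun j => by
      have hj : (0 : ℝ≥0∞) < (j + 1 : ℝ≥0∞)⁻¹ := by
        simp only [ENNReal.inv_pos]; finiteness
      obtain ⟨k, hk⟩ := (hlim.eventually (ge_mem_nhds hj)).exists
      exact ⟨φ k, hφ k, hI k, hk⟩)
    (fun j f hf => hCm f hf.1)
    (fun j f hf g hg => by
      refine ⟨C1c_smul (C1c_add hf.1 hg.1) _, ?_, ?_⟩
      · have h := regionalEnergy_midpoint_add σ Ω (hCm f hf.1) (hCm g hg.1)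
        have h4 : 4 * regionalEnergy σ Ω ((1 / 2 : ℝ) • (f + g)) ≤ 4 * M := by
          refine le_self_add.trans (h.le.trans ?_)
          calc _ ≤ 2 * M + 2 * M := by
                gcongr
                exacts [hf.2.1, hg.2.1]
            _ = 4 * M := by ring
        exact (ENNReal.mul_le_mul_iff_right (by norm_num) (by finiteness)).1 h4
      · have e : (1 / 2 : ℝ) • (f + g) - u = (1 / 2 : ℝ) • (f - u) + (1 / 2 : ℝ) • (g - u) := by
          ext x; simp; ring
        have hfm := (hCm f hf.1).aestronglyMeasurable.sub hu.1
        have hgm := (hCm g hg.1).aestronglyMeasurable.sub hu.1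
        rw [e]
        refine (eLpNorm_add_le (hfm.const_smul _) (hgm.const_smul _) one_le_two).trans ?_
        rw [eLpNorm_const_smul, eLpNorm_const_smul, ← mul_add]
        have h2 : ‖(1 / 2 : ℝ)‖ₑ = 2⁻¹ := by
          rw [Real.enorm_eq_ofReal (by norm_num), one_div, ENNReal.ofReal_inv_of_pos two_pos,
            ENNReal.ofReal_ofNat]
        rw [h2]
        calc _ ≤ (2⁻¹ : ℝ≥0∞) * ((j + 1 : ℝ≥0∞)⁻¹ + (j + 1 : ℝ≥0∞)⁻¹) := by
              gcongr
              exacts [hf.2.2, hg.2.2]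
          _ = _ := by
            rw [← two_mul, ← mul_assoc, ENNReal.inv_mul_cancel two_ne_zero (by finiteness), one_mul])
    hM (fun j f hf => hf.2.1)
  have hψu : Tendsto (fun j => eLpNorm (ψ j - u) 2 (volume.restrict Ω)) atTop (𝓝 0) := by
    have h1 : Tendsto (fun j : ℕ => ((j : ℝ≥0∞) + 1)⁻¹) atTop (𝓝 0) := by
      have := (tendsto_add_atTop_iff_nat 1).2 ENNReal.tendsto_inv_nat_nhds_zero
      simpa using this
    exact tendsto_of_tendsto_of_tendsto_of_le_of_le tendsto_const_nhds h1 (fun _ => zero_le)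
      fun j => (hψ j).2.2
  refine ⟨hu, ψ, fun j => (hψ j).1, hψu, ?_⟩
  obtain ⟨ns, hns, hae⟩ := (tendstoInMeasure_of_tendsto_eLpNorm two_ne_zero
    (fun j => (hCm _ (hψ j).1).aestronglyMeasurable) hu.1 hψu).exists_seq_tendsto_ae
  rw [ENNReal.tendsto_atTop_zero]
  intro δ hδ
  obtain ⟨N, hN⟩ := hcau δ hδ
  refine ⟨N, fun j hj => ?_⟩
  -- Fatou's lemma in the second index turns the Cauchy property into convergence to `u`.
  refine (regionalEnergy_le_liminf σ (Ω := Ω) (U := fun _ => Ω) (v := fun i => ψ j - ψ (ns i))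
    (fun _ => hΩ) (fun i => (hCm _ (hψ j).1).sub (hCm _ (hψ _).1)) ?_ ?_).trans ?_
  · filter_upwards [hae] with x hx
    exact tendsto_const_nhds.sub hx
  · filter_upwards [ae_restrict_mem hΩ] with x hx
    exact Eventually.of_forall fun _ => hx
  · refine (liminf_le_liminf (v := fun _ => δ) ?_).trans_eq (liminf_const δ)
    filter_upwards [hns.tendsto_atTop.eventually_ge_atTop N] with i hi
    exact hN j hj _ hi

/-- Compactness and lower semicontinuity along domains `U k ⊆ Ω` that exhaust `Ω`. -/
theorem exists_mem_HRing_of_tendsto {n : ℕ} {σ : ℝ} (hσ : 1 / 2 < σ) {Ω : Set (𝔼 n)}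
    (hΩ : IsOpen Ω) (hb : Bornology.IsBounded Ω) {U : ℕ → Set (𝔼 n)} (hU : ∀ k, IsOpen (U k))
    (hUΩ : ∀ k, U k ⊆ Ω) (hlim : ∀ x ∈ Ω, ∀ᶠ k in atTop, x ∈ U k) {φ : ℕ → (𝔼 n) → ℝ}
    (hφ : ∀ k, φ k ∈ C1c (U k)) (h1 : ∀ k, eLpNorm (φ k) 2 volume = 1) {L : ℝ≥0∞} (hL : L ≠ ∞)
    (hI : Tendsto (fun k => regionalEnergy σ (U k) (φ k)) atTop (𝓝 L)) :
    ∃ u ∈ HRing σ Ω, eLpNorm u 2 (volume.restrict Ω) = 1 ∧ regionalEnergy σ Ω u ≤ L := by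
  obtain ⟨C, hC, hHardy⟩ := exists_regionalEnergy_univ_le hσ
  -- The energies are below `L + 1` only from some index on, hence the shift by `N`.
  obtain ⟨N, hN⟩ := eventually_atTop.1 (hI.eventually (ge_mem_nhds
    (ENNReal.lt_add_right hL one_ne_zero)))
  have hIM : ∀ k, regionalEnergy σ Set.univ (φ (k + N)) ≤ C * (L + 1) := fun k =>
    (hHardy (hU _) _ (hφ _)).trans (by gcongr; exact hN _ (Nat.le_add_left _ _))
  have hφΩ : ∀ k, φ k ∈ C1c Ω := fun k => C1c_mono (hUΩ k) (hφ k)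
  have hcl : IsCompact (closure Ω) := hb.isCompact_closure
  obtain ⟨s, u, hs, hu, hsu⟩ := exists_subseq_tendsto_of_energy_bounded (by linarith : 0 < σ) hcl
    (M := C * (L + 1)) (by finiteness) (f := fun k => φ (k + N)) (fun k => C1c_continuous (hφ _))
    (fun k x hx => C1c_eq_zero (hφΩ _) fun h => hx (subset_closure h)) (fun k => (h1 _).le) hIM
  set θ : ℕ → ℕ := fun k => s k + N
  have hθ : Tendsto θ atTop atTop := 
    tendsto_atTop_mono (fun k => Nat.le_add_right _ _) hs.tendsto_atTop
  have hsu' : Tendsto (fun k => eLpNorm (φ (θ k) - u) 2 (volume.restrict Ω)) atTop (𝓝 0) :=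
    tendsto_of_tendsto_of_tendsto_of_le_of_le tendsto_const_nhds hsu (fun _ => zero_le)
      fun k => eLpNorm_restrict_le _ _ _ _
  have hur : MemLp u 2 (volume.restrict Ω) := hu.restrict Ω
  have hm : ∀ k, Measurable (φ k) := fun k => (C1c_continuous (hφ k)).measurable
  refine ⟨u, mem_HRing_of_tendsto hΩ.measurableSet hur (fun k => hφΩ (θ k)) hsu'
    (M := C * (L + 1)) (by finiteness)
    (fun k => (regionalEnergy_mono_set σ (Set.subset_univ _) _).trans (hIM _)), ?_, ?_⟩
  · have h2 := tendsto_eLpNorm_of_tendsto_eLpNorm_sub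
      (fun k => (hm (θ k)).aestronglyMeasurable) hur hsu'
    have h3 : ∀ k, eLpNorm (φ (θ k)) 2 (volume.restrict Ω) = 1 := fun k => by
      rw [eLpNorm_restrict_eq_of_support_subset, h1]
      exact (subset_tsupport _).trans (hφΩ _).2.2
    simp only [h3] at h2
    exact tendsto_nhds_unique h2 tendsto_const_nhds
  · obtain ⟨ns, hns, hae⟩ := (tendstoInMeasure_of_tendsto_eLpNorm two_ne_zero
      (fun j => (hm (θ j)).aestronglyMeasurable) hur.1 hsu').exists_seq_tendsto_ae
    have hθn : Tendsto (fun i => θ (ns i)) atTop atTop := hθ.comp hns.tendsto_atTop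
    refine (regionalEnergy_le_liminf σ (Ω := Ω) (U := fun i => U (θ (ns i)))
      (v := fun i => φ (θ (ns i))) (fun _ => (hU _).measurableSet) (fun i => hm _) hae ?_).trans
      (hI.comp hθn).liminf_eq.le
    filter_upwards [ae_restrict_mem hΩ.measurableSet] with x hx
    exact hθn.eventually (hlim x hx)

/-! ### The Rayleigh quotient and the first eigenvalue -/

/-- The infimum of the Rayleigh quotient of the regional energy over the test functions. -/
noncomputable def rayleighInf {n : ℕ} (σ : ℝ) (Ω : Set (𝔼 n)) : ℝ≥0∞ :=
  ⨅ φ ∈ {φ : (𝔼 n) → ℝ | φ ∈ C1c Ω ∧ eLpNorm φ 2 volume = 1}, regionalEnergy σ Ω φ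

theorem exists_C1c_eLpNorm_eq_one {n : ℕ} {Ω : Set (𝔼 n)} (hΩ : IsOpen Ω) (hne : Ω.Nonempty) :
    ∃ φ ∈ C1c Ω, eLpNorm φ 2 volume = 1 := by
  obtain ⟨x, hx⟩ := hne
  obtain ⟨f, hfs, hfc, hfd, -, hfx⟩ := exists_contDiff_tsupport_subset (n := 1) (hΩ.mem_nhds hx)
  have hf : f ∈ C1c Ω := ⟨by exact_mod_cast hfd, hfc, hfs⟩
  have h0 : eLpNorm f 2 volume ≠ 0 := by
    intro h
    rw [eLpNorm_eq_zero_iff hfd.continuous.aestronglyMeasurable two_ne_zero] at h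
    have := (hfd.continuous.ae_eq_iff_eq volume (g := 0) continuous_const).1 h
    rw [this] at hfx
    simp at hfx
  have ht := (C1c_memLp hf).2.ne
  refine ⟨(eLpNorm f 2 volume).toReal⁻¹ • f, C1c_smul hf _, ?_⟩
  rw [eLpNorm_const_smul, Real.enorm_eq_ofReal (by positivity),
    ENNReal.ofReal_inv_of_pos (ENNReal.toReal_pos h0 ht), ENNReal.ofReal_toReal ht,
    ENNReal.inv_mul_cancel h0 ht]

theorem rayleighInf_lt_top {n : ℕ} (hn : 0 < n) {σ : ℝ} (hσ : 0 < σ) (hσ' : σ < 1)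
    {Ω : Set (𝔼 n)} (hΩ : IsOpen Ω) (hne : Ω.Nonempty) : rayleighInf σ Ω < ∞ := by
  obtain ⟨φ, hφ, h1⟩ := exists_C1c_eLpNorm_eq_one hΩ hne
  exact (iInf₂_le φ ⟨hφ, h1⟩).trans_lt ((regionalEnergy_mono_set σ (Set.subset_univ _) _).trans_lt
    (regionalEnergy_univ_lt_top hn hσ hσ' hφ))

theorem rayleighInf_mul_le {n : ℕ} (σ : ℝ) {Ω : Set (𝔼 n)} {φ : (𝔼 n) → ℝ} (hφ : φ ∈ C1c Ω) :
    rayleighInf σ Ω * eLpNorm φ 2 volume ^ 2 ≤ regionalEnergy σ Ω φ := by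
  have ht := (C1c_memLp hφ).2.ne
  rcases eq_or_ne (eLpNorm φ 2 volume) 0 with h0 | h0
  · simp [h0]
  set c := (eLpNorm φ 2 volume).toReal with hc
  have hcpos : 0 < c := ENNReal.toReal_pos h0 ht
  have hce : eLpNorm φ 2 volume = ENNReal.ofReal c := (ENNReal.ofReal_toReal ht).symm
  have h1 : eLpNorm (c⁻¹ • φ) 2 volume = 1 := by
    rw [eLpNorm_const_smul, Real.enorm_eq_ofReal (by positivity),
      ENNReal.ofReal_inv_of_pos hcpos, hc, ENNReal.ofReal_toReal ht, ENNReal.inv_mul_cancel h0 ht]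
  have h2 : rayleighInf σ Ω ≤ regionalEnergy σ Ω (c⁻¹ • φ) := iInf₂_le _ ⟨C1c_smul hφ _, h1⟩
  rw [regionalEnergy_const_smul] at h2
  calc _ ≤ ENNReal.ofReal (c⁻¹ ^ 2) * regionalEnergy σ Ω φ * eLpNorm φ 2 volume ^ 2 := by gcongr
    _ = ENNReal.ofReal (c⁻¹ ^ 2 * c ^ 2) * regionalEnergy σ Ω φ := by
      rw [hce, ← ENNReal.ofReal_pow hcpos.le, ENNReal.ofReal_mul (by positivity)]; ring
    _ = _ := by
      rw [← mul_pow, inv_mul_cancel₀ hcpos.ne']; simp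

/-- The difference quotient whose `L²(Ω × Ω)` norm is the square root of the regional energy. -/
noncomputable def diffQuot {n : ℕ} (σ : ℝ) (u : (𝔼 n) → ℝ) (p : (𝔼 n) × (𝔼 n)) : ℝ :=
  (u p.1 - u p.2) / ‖p.1 - p.2‖ ^ (((n : ℝ) + 2 * σ) / 2)

theorem diffQuot_mul {n : ℕ} (σ : ℝ) (u v : (𝔼 n) → ℝ) (p : (𝔼 n) × (𝔼 n)) :
    diffQuot σ u p * diffQuot σ v p =
      (u p.1 - u p.2) * (v p.1 - v p.2) / ‖p.1 - p.2‖ ^ ((n : ℝ) + 2 * σ) := by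
  rw [diffQuot, diffQuot, div_mul_div_comm, ← sq, ← Real.rpow_mul_natCast (norm_nonneg _)]
  congr 2; push_cast; ring

/-- Writing the energy as a squared `L²` norm makes the triangle inequality and the expansion of
squares available for it. -/
theorem regionalEnergy_eq_eLpNorm {n : ℕ} (σ : ℝ) (Ω : Set (𝔼 n)) (u : (𝔼 n) → ℝ) :
    regionalEnergy σ Ω u = eLpNorm (diffQuot σ u) 2 (prodMeasure Ω) ^ 2 := by
  rw [eLpNorm_two_sq]
  simp only [sq (diffQuot σ u _), diffQuot_mul, regionalEnergy, sq]

theorem regionalForm_eq {n : ℕ} (σ : ℝ) (Ω : Set (𝔼 n)) (u v : (𝔼 n) → ℝ) :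
    regionalForm σ Ω u v = ∫ p, diffQuot σ u p * diffQuot σ v p ∂(prodMeasure Ω) := by
  simp only [diffQuot_mul, regionalForm]

theorem diffQuot_add {n : ℕ} (σ : ℝ) (u v : (𝔼 n) → ℝ) :
    diffQuot σ (u + v) = diffQuot σ u + diffQuot σ v := by
  ext p; simp only [diffQuot, Pi.add_apply]; ring

theorem diffQuot_smul {n : ℕ} (σ c : ℝ) (u : (𝔼 n) → ℝ) :
    diffQuot σ (c • u) = c • diffQuot σ u := by
  ext p; simp only [diffQuot, Pi.smul_apply, smul_eq_mul]; ring

theorem diffQuot_sub {n : ℕ} (σ : ℝ) (u v : (𝔼 n) → ℝ) :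
    diffQuot σ (u - v) = diffQuot σ u - diffQuot σ v := by
  ext p; simp only [diffQuot, Pi.sub_apply]; ring

theorem aestronglyMeasurable_diffQuot {n : ℕ} (σ : ℝ) {Ω : Set (𝔼 n)} {u : (𝔼 n) → ℝ}
    (hu : AEStronglyMeasurable u (volume.restrict Ω)) :
    AEStronglyMeasurable (diffQuot σ u) (prodMeasure Ω) := by
  have h1 : AEStronglyMeasurable (fun p : (𝔼 n) × (𝔼 n) => u p.1) (prodMeasure Ω) := hu.comp_fst
  have h2 : AEStronglyMeasurable (fun p : (𝔼 n) × (𝔼 n) => u p.2) (prodMeasure Ω) := hu.comp_snd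
  have h3 : Measurable fun p : (𝔼 n) × (𝔼 n) => ‖p.1 - p.2‖ ^ (((n : ℝ) + 2 * σ) / 2) := by
    fun_prop
  exact ((h1.sub h2).aemeasurable.div h3.aemeasurable).aestronglyMeasurable

theorem tendsto_regionalEnergy_iff {n : ℕ} (σ : ℝ) (Ω : Set (𝔼 n)) (w : ℕ → (𝔼 n) → ℝ) :
    Tendsto (fun k => regionalEnergy σ Ω (w k)) atTop (𝓝 0) ↔
      Tendsto (fun k => eLpNorm (diffQuot σ (w k)) 2 (prodMeasure Ω)) atTop (𝓝 0) := by
  simp only [regionalEnergy_eq_eLpNorm]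
  constructor
  · intro h
    have := ((ENNReal.continuous_rpow_const (y := 1 / 2)).tendsto 0).comp h
    rw [ENNReal.zero_rpow_of_pos (by norm_num)] at this
    refine this.congr fun k => ?_
    simp only [Function.comp]
    rw [← ENNReal.rpow_natCast, ← ENNReal.rpow_mul]; norm_num
  · intro h
    simpa using ENNReal.Tendsto.pow (n := 2) h

theorem HRing_add {n : ℕ} {σ : ℝ} {Ω : Set (𝔼 n)} {u v : (𝔼 n) → ℝ} (hu : u ∈ HRing σ Ω)
    (hv : v ∈ HRing σ Ω) : u + v ∈ HRing σ Ω := by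
  obtain ⟨hu2, φ, hφ, hφ1, hφ2⟩ := hu
  obtain ⟨hv2, ψ, hψ, hψ1, hψ2⟩ := hv
  have hφm : ∀ k, AEStronglyMeasurable (φ k - u) (volume.restrict Ω) := fun k =>
    (C1c_continuous (hφ k)).aestronglyMeasurable.sub hu2.1
  have hψm : ∀ k, AEStronglyMeasurable (ψ k - v) (volume.restrict Ω) := fun k =>
    (C1c_continuous (hψ k)).aestronglyMeasurable.sub hv2.1
  rw [tendsto_regionalEnergy_iff] at hφ2 hψ2
  refine ⟨hu2.add hv2, fun k => φ k + ψ k, fun k => C1c_add (hφ k) (hψ k), ?_, ?_⟩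
  · refine tendsto_of_tendsto_of_tendsto_of_le_of_le tendsto_const_nhds
      (by simpa using hφ1.add hψ1) (fun _ => zero_le) fun k => ?_
    rw [add_sub_add_comm]
    exact eLpNorm_add_le (hφm k) (hψm k) one_le_two
  · rw [tendsto_regionalEnergy_iff]
    refine tendsto_of_tendsto_of_tendsto_of_le_of_le tendsto_const_nhds
      (by simpa using hφ2.add hψ2) (fun _ => zero_le) fun k => ?_
    simp only
    rw [add_sub_add_comm, diffQuot_add]
    exact eLpNorm_add_le (aestronglyMeasurable_diffQuot σ (hφm k))
      (aestronglyMeasurable_diffQuot σ (hψm k)) one_le_two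

theorem HRing_smul {n : ℕ} {σ : ℝ} {Ω : Set (𝔼 n)} {u : (𝔼 n) → ℝ} (hu : u ∈ HRing σ Ω) (c : ℝ) :
    c • u ∈ HRing σ Ω := by
  obtain ⟨hu2, φ, hφ, hφ1, hφ2⟩ := hu
  refine ⟨hu2.const_smul c, fun k => c • φ k, fun k => C1c_smul (hφ k) c, ?_, ?_⟩
  · simp only [← smul_sub, eLpNorm_const_smul]
    simpa using ENNReal.Tendsto.const_mul hφ1 (Or.inr (by finiteness))
  · simp only [← smul_sub, regionalEnergy_const_smul]
    simpa using ENNReal.Tendsto.const_mul hφ2 (Or.inr ENNReal.ofReal_ne_top)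

theorem memLp_diffQuot_of_C1c {n : ℕ} (hn : 0 < n) {σ : ℝ} (hσ : 0 < σ) (hσ' : σ < 1)
    {Ω : Set (𝔼 n)} {φ : (𝔼 n) → ℝ} (hφ : φ ∈ C1c Ω) : MemLp (diffQuot σ φ) 2 (prodMeasure Ω) := by
  refine ⟨aestronglyMeasurable_diffQuot σ (C1c_continuous hφ).aestronglyMeasurable, ?_⟩
  have := (regionalEnergy_mono_set σ (Set.subset_univ Ω) φ).trans_lt
    (regionalEnergy_univ_lt_top hn hσ hσ' hφ)
  rw [regionalEnergy_eq_eLpNorm] at this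
  exact (ENNReal.pow_lt_top_iff.1 this).resolve_right two_ne_zero

theorem memLp_diffQuot {n : ℕ} (hn : 0 < n) {σ : ℝ} (hσ : 0 < σ) (hσ' : σ < 1)
    {Ω : Set (𝔼 n)} {u : (𝔼 n) → ℝ} (hu : u ∈ HRing σ Ω) :
    MemLp (diffQuot σ u) 2 (prodMeasure Ω) := by
  obtain ⟨hu2, φ, hφ, hφ1, hφ2⟩ := hu
  rw [tendsto_regionalEnergy_iff] at hφ2
  obtain ⟨k, hk⟩ := (hφ2.eventually (gt_mem_nhds one_pos)).exists
  have h1 : MemLp (diffQuot σ (φ k - u)) 2 (prodMeasure Ω) :=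
    ⟨aestronglyMeasurable_diffQuot σ
      ((C1c_continuous (hφ k)).aestronglyMeasurable.sub hu2.1), hk.trans ENNReal.one_lt_top⟩
  have h2 := (memLp_diffQuot_of_C1c hn hσ hσ' (hφ k)).sub h1
  rwa [diffQuot_sub, sub_sub_cancel] at h2

/-- Both sides are continuous along the approximating test functions, for which the inequality holds
by homogeneity. -/
theorem rayleighInf_mul_le_of_mem_HRing {n : ℕ} (hn : 0 < n) {σ : ℝ} (hσ : 0 < σ) (hσ' : σ < 1)
    {Ω : Set (𝔼 n)} (hΩ : IsOpen Ω) (hne : Ω.Nonempty) {u : (𝔼 n) → ℝ} (hu : u ∈ HRing σ Ω) :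
    rayleighInf σ Ω * eLpNorm u 2 (volume.restrict Ω) ^ 2 ≤ regionalEnergy σ Ω u := by
  have hD := memLp_diffQuot hn hσ hσ' hu
  obtain ⟨hu2, φ, hφ, hφ1, hφ2⟩ := hu
  rw [tendsto_regionalEnergy_iff] at hφ2
  simp only [diffQuot_sub] at hφ2
  have h1 := tendsto_eLpNorm_of_tendsto_eLpNorm_sub
    (fun k => (C1c_continuous (hφ k)).aestronglyMeasurable) hu2 hφ1
  have h2 := tendsto_eLpNorm_of_tendsto_eLpNorm_sub
    (fun k => (memLp_diffQuot_of_C1c hn hσ hσ' (hφ k)).1) hD hφ2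
  rw [regionalEnergy_eq_eLpNorm]
  refine le_of_tendsto_of_tendsto' (ENNReal.Tendsto.const_mul (ENNReal.Tendsto.pow (n := 2) h1)
    (Or.inr (rayleighInf_lt_top hn hσ hσ' hΩ hne).ne)) (ENNReal.Tendsto.pow (n := 2) h2)
    fun k => ?_
  rw [eLpNorm_restrict_eq_of_support_subset ((subset_tsupport _).trans (hφ k).2.2),
    ← regionalEnergy_eq_eLpNorm]
  exact rayleighInf_mul_le σ (hφ k)

theorem integral_sq_eq_toReal {α : Type*} [MeasurableSpace α] {μ : Measure α} {f : α → ℝ}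
    (hf : AEStronglyMeasurable f μ) : ∫ x, f x * f x ∂μ = (eLpNorm f 2 μ ^ 2).toReal := by
  rw [eLpNorm_two_sq, integral_eq_lintegral_of_nonneg_ae
    (Eventually.of_forall fun x => mul_self_nonneg _) (hf.mul hf)]
  simp only [sq]

theorem rayleighInf_toReal_mul_le {n : ℕ} (hn : 0 < n) {σ : ℝ} (hσ : 0 < σ) (hσ' : σ < 1)
    {Ω : Set (𝔼 n)} (hΩ : IsOpen Ω) (hne : Ω.Nonempty) {u : (𝔼 n) → ℝ} (hu : u ∈ HRing σ Ω) :
    (rayleighInf σ Ω).toReal * ∫ x in Ω, u x * u x ≤ regionalForm σ Ω u u := by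
  have hD := memLp_diffQuot hn hσ hσ' hu
  rw [integral_sq_eq_toReal hu.1.1, regionalForm_eq, integral_sq_eq_toReal hD.1,
    ← ENNReal.toReal_mul]
  refine ENNReal.toReal_mono (ENNReal.pow_ne_top hD.2.ne) ?_
  rw [← regionalEnergy_eq_eLpNorm]
  exact rayleighInf_mul_le_of_mem_HRing hn hσ hσ' hΩ hne hu

theorem integral_add_smul_mul_self {α : Type*} [MeasurableSpace α] {μ : Measure α} {f g : α → ℝ}
    (hf : MemLp f 2 μ) (hg : MemLp g 2 μ) (t : ℝ) :
    ∫ x, (f + t • g) x * (f + t • g) x ∂μ =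
      ∫ x, f x * f x ∂μ + 2 * t * ∫ x, f x * g x ∂μ + t ^ 2 * ∫ x, g x * g x ∂μ := by
  have h1 : Integrable (fun x => f x * f x) μ := hf.integrable_mul hf
  have h2 : Integrable (fun x => f x * g x) μ := hf.integrable_mul hg
  have h3 : Integrable (fun x => g x * g x) μ := hg.integrable_mul hg
  rw [← integral_const_mul, ← integral_const_mul, ← integral_add h1 (h2.const_mul _),
    ← integral_add (f := fun x => f x * f x + 2 * t * (f x * g x)) (h1.add (h2.const_mul _)) (h3.const_mul _)]
  refine integral_congr_ae (Eventually.of_forall fun x => ?_)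
  simp only [Pi.add_apply, Pi.smul_apply, smul_eq_mul]; ring

theorem eq_zero_of_forall_quadratic_nonneg {b c : ℝ} (h : ∀ t : ℝ, 0 ≤ 2 * t * b + t ^ 2 * c) :
    b = 0 := by
  have h1 : discrim c (2 * b) 0 ≤ 0 := discrim_le_zero fun t => by
    have := h t; nlinarith
  rw [discrim] at h1
  nlinarith [sq_nonneg b]

/-- A minimizer of the Rayleigh quotient is an eigenfunction. -/
theorem isEigenfunction_of_minimizer {n : ℕ} (hn : 0 < n) {σ : ℝ} (hσ : 0 < σ) (hσ' : σ < 1)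
    {Ω : Set (𝔼 n)} (hΩ : IsOpen Ω) (hne : Ω.Nonempty) {u : (𝔼 n) → ℝ} (hu : u ∈ HRing σ Ω)
    (h1 : eLpNorm u 2 (volume.restrict Ω) = 1) (hmin : regionalEnergy σ Ω u ≤ rayleighInf σ Ω) :
    IsEigenfunction σ Ω (rayleighInf σ Ω).toReal u := by
  have hr := (rayleighInf_lt_top hn hσ hσ' hΩ hne).ne
  refine ⟨hu, fun h0 => ?_, fun φ hφ => ?_⟩
  · rw [eLpNorm_congr_ae h0] at h1
    simp at h1
  have hD := memLp_diffQuot hn hσ hσ' hu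
  have hDφ := memLp_diffQuot hn hσ hσ' hφ
  set l := (rayleighInf σ Ω).toReal
  have hu1 : ∫ x in Ω, u x * u x = 1 := by rw [integral_sq_eq_toReal hu.1.1, h1]; simp
  have huu : regionalForm σ Ω u u ≤ l := by
    rw [regionalForm_eq, integral_sq_eq_toReal hD.1, ← regionalEnergy_eq_eLpNorm]
    exact ENNReal.toReal_mono hr hmin
  -- The energy of `u + tφ` minus `l` times its squared norm is nonnegative, while its value at `t =
  -- 0` is at most 0 by minimality. A nonnegative quadratic without constant term has no linear
  -- term, which is the weak equation.
  have key : ∀ t : ℝ, 0 ≤ 2 * t * (regionalForm σ Ω u φ - l * ∫ x in Ω, u x * φ x) +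
      t ^ 2 * (regionalForm σ Ω φ φ - l * ∫ x in Ω, φ x * φ x) := by
    intro t
    have h := rayleighInf_toReal_mul_le hn hσ hσ' hΩ hne (HRing_add hu (HRing_smul hφ t))
    rw [integral_add_smul_mul_self hu.1 hφ.1, regionalForm_eq, diffQuot_add, diffQuot_smul,
      integral_add_smul_mul_self hD hDφ, ← regionalForm_eq, ← regionalForm_eq, ← regionalForm_eq,
      hu1] at h
    change l * _ ≤ _ at h
    nlinarith
  linarith [eq_zero_of_forall_quadratic_nonneg key]

theorem exists_minimizing_seq {n : ℕ} {σ : ℝ} {Ω : Set (𝔼 n)} (hr : rayleighInf σ Ω ≠ ∞)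
    {ε : ℝ≥0∞} (hε : ε ≠ 0) : ∃ φ ∈ C1c Ω, eLpNorm φ 2 volume = 1 ∧
      regionalEnergy σ Ω φ < rayleighInf σ Ω + ε := by
  have : rayleighInf σ Ω < rayleighInf σ Ω + ε := ENNReal.lt_add_right hr hε
  conv_lhs at this => rw [rayleighInf]
  simp only [iInf_lt_iff] at this
  obtain ⟨φ, hφ, h⟩ := this
  exact ⟨φ, hφ.1, hφ.2, h⟩

/-- On a bounded open set the infimum of the Rayleigh quotient is the smallest eigenvalue. -/
theorem isLeast_eigenvalues {n : ℕ} (hn : 0 < n) {σ : ℝ} (hσ : 1 / 2 < σ) (hσ' : σ < 1)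
    {Ω : Set (𝔼 n)} (hΩ : IsOpen Ω) (hne : Ω.Nonempty) (hb : Bornology.IsBounded Ω) :
    IsLeast (eigenvalues σ Ω) (rayleighInf σ Ω).toReal := by
  have hσ0 : 0 < σ := by linarith
  have hr := (rayleighInf_lt_top hn hσ0 hσ' hΩ hne).ne
  refine ⟨?_, ?_⟩
  · choose φ hφ h1 hφr using fun k : ℕ => exists_minimizing_seq hr (ε := (k : ℝ≥0∞)⁻¹)
      (by simp)
    have hlim : Tendsto (fun k => regionalEnergy σ Ω (φ k)) atTop (𝓝 (rayleighInf σ Ω)) :=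
      tendsto_of_tendsto_of_tendsto_of_le_of_le tendsto_const_nhds
        (by simpa using tendsto_const_nhds.add ENNReal.tendsto_inv_nat_nhds_zero)
        (fun k => iInf₂_le _ ⟨hφ k, h1 k⟩) fun k => (hφr k).le
    obtain ⟨u, hu, hu1, huI⟩ := exists_mem_HRing_of_tendsto hσ hΩ hb (U := fun _ => Ω)
      (fun _ => hΩ) (fun _ => subset_rfl) (fun x hx => Eventually.of_forall fun _ => hx) hφ h1 hr
      hlim
    exact ⟨u, isEigenfunction_of_minimizer hn hσ0 hσ' hΩ hne hu hu1 huI⟩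
  -- Testing the equation of any eigenfunction with itself shows that its eigenvalue is its Rayleigh
  -- quotient.
  · rintro l ⟨u, hu, hu0, hul⟩
    have h := rayleighInf_toReal_mul_le hn hσ0 hσ' hΩ hne hu
    rw [hul u hu] at h
    refine le_of_mul_le_mul_right h ?_
    rw [integral_sq_eq_toReal hu.1.1]
    refine ENNReal.toReal_pos (pow_ne_zero 2 ?_) (ENNReal.pow_ne_top hu.1.2.ne)
    rwa [ne_eq, eLpNorm_eq_zero_iff hu.1.1 two_ne_zero]

theorem firstEigenvalue_eq {n : ℕ} (hn : 0 < n) {σ : ℝ} (hσ : 1 / 2 < σ) (hσ' : σ < 1)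
    {Ω : Set (𝔼 n)} (hΩ : IsOpen Ω) (hne : Ω.Nonempty) (hb : Bornology.IsBounded Ω) :
    firstEigenvalue σ Ω = (rayleighInf σ Ω).toReal :=
  (isLeast_eigenvalues hn hσ hσ' hΩ hne hb).csInf_eq

/-! ### Exclusion of thin domains and the diameter bound -/

/-- From each `x ∈ Ω` at least half of the ball `B(x, ε)` lies where `φ` vanishes, and the kernel is
bounded below there. So `x` contributes at least a multiple of `φ(x)²`, and the multiple blows up as
`ε → 0`. -/
theorem kern_mul_half_volume_le_regionalEnergy {n : ℕ} {σ : ℝ} (hσ : 0 < σ) {Ω : Set (𝔼 n)}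
    (hΩ : IsOpen Ω) {φ : (𝔼 n) → ℝ} (hφ : φ ∈ C1c Ω) (h1 : eLpNorm φ 2 volume = 1) {ε : ℝ}
    (hε : 0 < ε) (hsmall : ∀ x ∈ Ω, 2 * volume (Ω ∩ Metric.ball x ε) ≤
      volume (Metric.ball (0 : 𝔼 n) ε)) :
    (2 * (ENNReal.ofReal (2 * (2 * ε) ^ ((n : ℝ) + 2 * σ)) /
      volume (Metric.ball (0 : 𝔼 n) ε)))⁻¹ ≤ regionalEnergy σ Set.univ φ := by
  have hk := measurable_kern (n := n) σ
  have hm := (C1c_continuous hφ).measurable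
  set V := volume (Metric.ball (0 : 𝔼 n) ε)
  have hVt : V ≠ ∞ := measure_ball_lt_top.ne
  have hV0 : V ≠ 0 := (Metric.measure_ball_pos volume _ hε).ne'
  set A := ENNReal.ofReal (2 * (2 * ε) ^ ((n : ℝ) + 2 * σ))
  -- At `h = 0` the convention `0⁻¹ = 0` makes `kern` vanish, so this point is excluded.
  have hkern : ∀ h : 𝔼 n, h ≠ 0 → ‖h‖ < ε → A⁻¹ ≤ kern σ h := by
    intro h h0 hh
    have hpos : 0 < ‖h‖ := norm_pos_iff.2 h0
    rw [kern, ENNReal.ofReal_inv_of_pos (by positivity), ENNReal.inv_le_inv]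
    refine ENNReal.ofReal_le_ofReal ?_
    have : ‖h‖ ^ ((n : ℝ) + 2 * σ) ≤ (2 * ε) ^ ((n : ℝ) + 2 * σ) :=
      Real.rpow_le_rpow hpos.le (by linarith) (by positivity)
    have h2 : 0 ≤ (2 * ε) ^ ((n : ℝ) + 2 * σ) := by positivity
    linarith
  have key : ∀ x, ENNReal.ofReal (φ x ^ 2) * (2 * (A / V))⁻¹ ≤
      ∫⁻ y, ENNReal.ofReal ((φ x - φ y) ^ 2) * kern σ (x - y) := by
    intro x
    by_cases hx : x ∈ Ω
    swap
    · simp [C1c_eq_zero hφ hx]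
    have hB : MeasurableSet (Metric.ball x ε \ Ω) := measurableSet_ball.diff hΩ.measurableSet
    have hVB : V ≤ 2 * volume (Metric.ball x ε \ Ω) := by
      have e : volume (Metric.ball x ε ∩ Ω) + volume (Metric.ball x ε \ Ω) = V := by
        rw [measure_inter_add_sdiff _ hΩ.measurableSet]
        exact Measure.addHaar_ball_center _ _ _
      have h2 := hsmall x hx
      rw [Set.inter_comm] at h2
      have h3 : V + V ≤ V + 2 * volume (Metric.ball x ε \ Ω) := by
        calc V + V = 2 * volume (Metric.ball x ε ∩ Ω) + 2 * volume (Metric.ball x ε \ Ω) := by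
              rw [← mul_add, e, two_mul]
          _ ≤ _ := by gcongr
      exact (ENNReal.add_le_add_iff_left hVt).1 h3
    calc ENNReal.ofReal (φ x ^ 2) * (2 * (A / V))⁻¹
        ≤ ENNReal.ofReal (φ x ^ 2) * (A⁻¹ * volume (Metric.ball x ε \ Ω)) := by
          gcongr
          rw [ENNReal.mul_inv (Or.inl two_ne_zero) (Or.inl ENNReal.ofNat_ne_top),
            ENNReal.inv_div (Or.inl hVt) (Or.inl hV0), div_eq_mul_inv, mul_left_comm, mul_comm V,
            mul_comm 2⁻¹, mul_assoc]
          gcongr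
          rw [mul_comm, ← div_eq_mul_inv]
          exact ENNReal.div_le_of_le_mul' hVB
      _ = ∫⁻ y in Metric.ball x ε \ Ω, ENNReal.ofReal (φ x ^ 2) * A⁻¹ := by
          rw [setLIntegral_const, mul_assoc]
      _ ≤ ∫⁻ y in Metric.ball x ε \ Ω, ENNReal.ofReal ((φ x - φ y) ^ 2) * kern σ (x - y) := by
          refine setLIntegral_mono' hB fun y hy => ?_
          rw [C1c_eq_zero hφ hy.2, sub_zero]
          gcongr
          refine hkern _ (fun h => hy.2 ?_) ?_
          · rwa [← sub_eq_zero.1 h]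
          · rw [← dist_eq_norm, dist_comm]; exact hy.1
      _ ≤ _ := setLIntegral_le_lintegral _ _
  calc (2 * (A / V))⁻¹ = ∫⁻ x, ENNReal.ofReal (φ x ^ 2) * (2 * (A / V))⁻¹ := by
        rw [lintegral_mul_const _ (by fun_prop), ← eLpNorm_two_sq, h1, one_pow, one_mul]
    _ ≤ _ := lintegral_mono key
    _ = _ := by
        rw [regionalEnergy_eq, Set.univ_prod_univ, setLIntegral_univ,
          lintegral_prod _ (by fun_prop)]

/-- A bound on the energy of a normalized test function in `Ω` forces `Ω` to fill at least half of
some ball of fixed radius. -/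
theorem exists_radius_half_ball {n : ℕ} {σ : ℝ} (hσ : 1 / 2 < σ) {Λ : ℝ≥0∞} (hΛ : Λ ≠ ∞) :
    ∃ R > 0, ∀ {Ω : Set (𝔼 n)}, IsOpen Ω → ∀ φ ∈ C1c Ω, eLpNorm φ 2 volume = 1 →
      regionalEnergy σ Ω φ ≤ Λ →
      ∃ x ∈ Ω, volume (Metric.ball (0 : 𝔼 n) R) < 2 * volume (Ω ∩ Metric.ball x R) := by
  obtain ⟨C, hC, hHardy⟩ := exists_regionalEnergy_univ_le hσ
  -- The radius is chosen so that failure of the claim would force a whole-space energy of at least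
  -- `C * Λ + 1`, against the Hardy bound `C * Λ`.
  have hη : 0 < (2 * (C * Λ + 1))⁻¹ := by
    rw [ENNReal.inv_pos]; finiteness
  obtain ⟨R, hR, hR0⟩ := (((tendsto_ball_coeff (n := n) (by linarith : 0 < σ)).eventually
    (gt_mem_nhds hη)).and self_mem_nhdsWithin).exists
  have hR0 : 0 < R := hR0
  refine ⟨R, hR0, fun {Ω} hΩ φ hφ h1 hI => ?_⟩
  by_contra! hcon
  have h2 := (kern_mul_half_volume_le_regionalEnergy (by linarith : 0 < σ) hΩ hφ h1 hR0 hcon).trans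
    ((hHardy hΩ φ hφ).trans (mul_le_mul_right hI C))
  set q := ENNReal.ofReal (2 * (2 * R) ^ ((n : ℝ) + 2 * σ)) / volume (Metric.ball (0 : 𝔼 n) R)
  have h3 : C * Λ + 1 ≤ (2 * q)⁻¹ := by
    rw [ENNReal.le_inv_iff_le_inv]
    calc 2 * q ≤ 2 * (2 * (C * Λ + 1))⁻¹ := by gcongr
      _ = (C * Λ + 1)⁻¹ := by
        rw [ENNReal.mul_inv (Or.inl two_ne_zero) (Or.inl ENNReal.ofNat_ne_top), ← mul_assoc,
          ENNReal.mul_inv_cancel two_ne_zero ENNReal.ofNat_ne_top, one_mul]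
  exact absurd (h3.trans h2) (not_le.2 (ENNReal.lt_add_right (by finiteness) one_ne_zero))

/-- Contracted copies of a piece of a convex set towards a far point are disjoint. -/
theorem card_mul_volume_le_of_convex {n : ℕ} {Ω : Set (𝔼 n)} (hc : Convex ℝ Ω) (hΩ : IsOpen Ω)
    {x y : 𝔼 n} (hy : y ∈ Ω) {R : ℝ} {N : ℕ} (hN : 0 < N) (hfar : 4 * N * R ≤ dist y x) :
    (N : ℝ≥0∞) * (ENNReal.ofReal ((1 / 2) ^ n) * volume (Ω ∩ Metric.ball x R)) ≤ volume Ω := by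
  set S := Ω ∩ Metric.ball x R
  have hN' : (0 : ℝ) < N := by exact_mod_cast hN
  -- For `i < N` the ratios `1 - t i` are at least `1/2`, so each copy keeps the fraction `2^{-n}`
  -- of the volume. Consecutive copies are shifted by `dist y x / (2N) ≥ 2R`, and each stays within
  -- `R` of its shifted centre, hence they are disjoint.
  let t : ℕ → ℝ := fun i => i / (2 * N)
  have ht0 : ∀ i, 0 ≤ t i := fun i => by positivity
  have ht1 : ∀ i ∈ Finset.range N, t i ≤ 1 / 2 := fun i hi => by
    have : (i : ℝ) ≤ N := by exact_mod_cast (Finset.mem_range.1 hi).le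
    simp only [t]
    rw [div_le_div_iff₀ (by positivity) two_pos]; linarith
  let T : ℕ → Set (𝔼 n) := fun i => AffineMap.homothety y (1 - t i) '' S
  have happ : ∀ i z, AffineMap.homothety y (1 - t i) z = (1 - t i) • z + t i • y := fun i z => by
    rw [AffineMap.homothety_apply, vsub_eq_sub, vadd_eq_add, smul_sub, sub_smul, sub_smul, one_smul,
      one_smul]
    abel
  have hTsub : ∀ i ∈ Finset.range N, T i ⊆ Ω := by
    rintro i hi _ ⟨z, hz, rfl⟩
    rw [happ]
    exact hc hz.1 hy (by linarith [ht1 i hi]) (ht0 i) (by ring)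
  have hTm : ∀ i ∈ Finset.range N, MeasurableSet (T i) := by
    intro i hi
    have h1 : 1 - t i ≠ 0 := by linarith [ht1 i hi]
    exact ((AffineMap.homothety_isOpenMap y _ h1) _ (hΩ.inter Metric.isOpen_ball)).measurableSet
  have hTv : ∀ i ∈ Finset.range N, ENNReal.ofReal ((1 / 2) ^ n) * volume S ≤ volume (T i) := by
    intro i hi
    rw [Measure.addHaar_image_homothety, finrank_euclideanSpace_fin]
    gcongr
    have h1 := ht1 i hi
    rw [abs_of_nonneg (pow_nonneg (by linarith) n)]
    gcongr
    linarith
  have hsep : ∀ i j, i < j → j ∈ Finset.range N → Disjoint (T i) (T j) := by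
    intro i j hij hj
    have hi : i ∈ Finset.range N := Finset.mem_range.2 (hij.trans (Finset.mem_range.1 hj))
    rw [Set.disjoint_left]
    rintro _ ⟨z, hz, rfl⟩ ⟨w, hw, hzw⟩
    rw [happ, happ] at hzw
    have hzx : ‖z - x‖ < R := by rw [← dist_eq_norm]; exact hz.2
    have hwx : ‖w - x‖ < R := by rw [← dist_eq_norm]; exact hw.2
    have e : (t j - t i) • (y - x) = (1 - t i) • (z - x) - (1 - t j) • (w - x) := by
      have : (1 - t j) • w = (1 - t i) • z + t i • y - t j • y := by
        rw [← hzw]; abel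
      rw [smul_sub _ w x, this]
      module
    have hd : 1 / (2 * N) ≤ t j - t i := by
      have : (i : ℝ) + 1 ≤ j := by exact_mod_cast hij
      simp only [t]
      rw [← sub_div]
      gcongr
      linarith
    have h1 : (t j - t i) * ‖y - x‖ < R + R := by
      calc (t j - t i) * ‖y - x‖ = ‖(t j - t i) • (y - x)‖ := by
            rw [norm_smul, Real.norm_of_nonneg (le_trans (by positivity) hd)]
        _ ≤ ‖(1 - t i) • (z - x)‖ + ‖(1 - t j) • (w - x)‖ := by rw [e]; exact norm_sub_le _ _
        _ ≤ ‖z - x‖ + ‖w - x‖ := by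
            rw [norm_smul, norm_smul, Real.norm_of_nonneg (by linarith [ht1 i hi]),
              Real.norm_of_nonneg (by linarith [ht1 j hj])]
            gcongr
            · exact mul_le_of_le_one_left (norm_nonneg _) (by linarith [ht0 i])
            · exact mul_le_of_le_one_left (norm_nonneg _) (by linarith [ht0 j])
        _ < R + R := by linarith
    have h2 : 1 / (2 * N) * (4 * N * R) ≤ (t j - t i) * ‖y - x‖ := by
      rw [← dist_eq_norm]
      have hRpos : 0 < R := (norm_nonneg _).trans_lt hzx
      gcongr
      exact le_trans (by positivity) hd
    have h3 : 1 / (2 * N) * (4 * N * R) = 2 * R := by field_simp; ring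
    linarith
  have hdisj : (↑(Finset.range N) : Set ℕ).PairwiseDisjoint T := by
    intro i hi j hj hij
    rcases lt_or_gt_of_ne hij with h | h
    · exact hsep i j h hj
    · exact (hsep j i h hi).symm
  calc (N : ℝ≥0∞) * (ENNReal.ofReal ((1 / 2) ^ n) * volume S)
      = ∑ i ∈ Finset.range N, ENNReal.ofReal ((1 / 2) ^ n) * volume S := by simp
    _ ≤ ∑ i ∈ Finset.range N, volume (T i) := Finset.sum_le_sum hTv
    _ = volume (⋃ i ∈ Finset.range N, T i) := (measure_biUnion_finset hdisj hTm).symm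
    _ ≤ volume Ω := measure_mono (Set.iUnion₂_subset hTsub)

/-- A convex set of volume `1` that fills half of a ball of fixed radius has bounded diameter. -/
theorem exists_subset_ball_of_half_ball {n : ℕ} {R : ℝ} (hR : 0 < R) :
    ∃ D : ℝ, ∀ Ω ∈ convexUnitVolume n, ∀ x ∈ Ω,
      volume (Metric.ball (0 : 𝔼 n) R) < 2 * volume (Ω ∩ Metric.ball x R) →
      Ω ⊆ Metric.ball x D := by
  set V := volume (Metric.ball (0 : 𝔼 n) R)
  have hV0 : V ≠ 0 := (Metric.measure_ball_pos volume _ hR).ne'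
  have hq : ENNReal.ofReal ((1 / 2) ^ n) * V ≠ 0 :=
    mul_ne_zero (by rw [ne_eq, ENNReal.ofReal_eq_zero, not_le]; positivity) hV0
  -- The piece of `Ω` has volume more than `V/2`, so `N * 2^{-n} * V > 2` makes the `N` disjoint
  -- copies exceed the total volume 1.
  obtain ⟨N, hN⟩ := ENNReal.exists_nat_mul_gt hq ENNReal.ofNat_ne_top (b := 2)
  have hN0 : 0 < N := by
    rcases Nat.eq_zero_or_pos N with rfl | h
    · simp at hN
    · exact h
  refine ⟨4 * N * R, fun Ω hΩ x hx hV y hy => ?_⟩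
  rw [Metric.mem_ball]
  by_contra! hfar
  have h1 := card_mul_volume_le_of_convex hΩ.1 hΩ.2.1 hy hN0 hfar
  rw [hΩ.2.2] at h1
  have h2 : (2 : ℝ≥0∞) < 2 := by
    calc (2 : ℝ≥0∞) < N * (ENNReal.ofReal ((1 / 2) ^ n) * V) := hN
      _ ≤ N * (ENNReal.ofReal ((1 / 2) ^ n) * (2 * volume (Ω ∩ Metric.ball x R))) := by gcongr
      _ = 2 * (N * (ENNReal.ofReal ((1 / 2) ^ n) * volume (Ω ∩ Metric.ball x R))) := by ring
      _ ≤ 2 * 1 := by gcongr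
      _ = 2 := mul_one _
  exact lt_irrefl _ h2

theorem nonempty_of_mem_convexUnitVolume {n : ℕ} {Ω : Set (𝔼 n)} (hΩ : Ω ∈ convexUnitVolume n) :
    Ω.Nonempty := 
  nonempty_of_measure_ne_zero (μ := (volume : Measure (𝔼 n))) (by rw [hΩ.2.2]; exact one_ne_zero)

/-- A ball contained in `Ω` fills more than half of itself, so the diameter bound applies. -/
theorem isBounded_of_mem_convexUnitVolume {n : ℕ} {Ω : Set (𝔼 n)} (hΩ : Ω ∈ convexUnitVolume n) :
    Bornology.IsBounded Ω := by
  obtain ⟨x, hx⟩ := nonempty_of_mem_convexUnitVolume hΩ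
  obtain ⟨R, hR, hsub⟩ := Metric.isOpen_iff.1 hΩ.2.1 x hx
  obtain ⟨D, hD⟩ := exists_subset_ball_of_half_ball (n := n) hR
  refine Metric.isBounded_ball.subset (hD Ω hΩ x hx ?_)
  have hpos : volume (Metric.ball (0 : 𝔼 n) R) ≠ 0 := (Metric.measure_ball_pos volume _ hR).ne'
  have hfin : volume (Metric.ball (0 : 𝔼 n) R) ≠ ∞ := measure_ball_lt_top.ne
  rw [Set.inter_eq_self_of_subset_right hsub, Measure.addHaar_ball_center volume x, two_mul]
  exact ENNReal.lt_add_right hfin hpos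

/-! ### Hausdorff limits of convex sets and Blaschke selection -/

theorem TopologicalSpace.NonemptyCompacts.exists_dist_lt {α : Type*} [MetricSpace α]
    {A B : TopologicalSpace.NonemptyCompacts α} {r : ℝ} (h : dist A B < r) {x : α} (hx : x ∈ A) :
    ∃ y ∈ B, dist x y < r :=
  Metric.exists_dist_lt_of_hausdorffDist_lt hx h
    (Metric.hausdorffEDist_ne_top_of_nonempty_of_bounded A.nonempty B.nonempty
      A.isCompact.isBounded B.isCompact.isBounded)

/-- A Hausdorff limit of convex compact sets is convex. -/
theorem convex_of_tendsto_nonemptyCompacts {n : ℕ}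
    {A : ℕ → TopologicalSpace.NonemptyCompacts (𝔼 n)} {K : TopologicalSpace.NonemptyCompacts (𝔼 n)}
    (hA : ∀ k, Convex ℝ (A k : Set (𝔼 n))) (hlim : Tendsto A atTop (𝓝 K)) :
    Convex ℝ (K : Set (𝔼 n)) := by
  intro x hx y hy a b ha hb hab
  rw [← K.isCompact.isClosed.closure_eq, Metric.mem_closure_iff]
  intro ε hε
  obtain ⟨k, hk⟩ := (hlim.eventually (Metric.ball_mem_nhds K (half_pos hε))).exists
  have hk : dist (A k) K < ε / 2 := hk
  obtain ⟨x', hx', hxx⟩ := TopologicalSpace.NonemptyCompacts.exists_dist_lt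
    (by rwa [dist_comm] : dist K (A k) < ε / 2) hx
  obtain ⟨y', hy', hyy⟩ := TopologicalSpace.NonemptyCompacts.exists_dist_lt
    (by rwa [dist_comm] : dist K (A k) < ε / 2) hy
  obtain ⟨z, hz, hzz⟩ := TopologicalSpace.NonemptyCompacts.exists_dist_lt hk
    (hA k hx' hy' ha hb hab)
  refine ⟨z, hz, ?_⟩
  have h1 : dist (a • x + b • y) (a • x' + b • y') ≤ ε / 2 := by
    rw [dist_eq_norm] at hxx hyy ⊢
    have e : a • x + b • y - (a • x' + b • y') = a • (x - x') + b • (y - y') := by module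
    rw [e]
    calc _ ≤ ‖a • (x - x')‖ + ‖b • (y - y')‖ := norm_add_le _ _
      _ = a * ‖x - x'‖ + b * ‖y - y'‖ := by
        rw [norm_smul, norm_smul, Real.norm_of_nonneg ha, Real.norm_of_nonneg hb]
      _ ≤ a * (ε / 2) + b * (ε / 2) := by gcongr
      _ = ε / 2 := by rw [← add_mul, hab, one_mul]
  linarith [dist_triangle (a • x + b • y) (a • x' + b • y') z]

/-- If a ball is contained in the `r`-neighbourhood of an open convex set `W` and has radius
larger than `r`, then its centre belongs to `W`. -/
theorem mem_of_ball_subset_thickening {n : ℕ} {W : Set (𝔼 n)} (hW : Convex ℝ W) (hWo : IsOpen W)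
    {x : 𝔼 n} {r ρ : ℝ} (hr : r < ρ) (hρ : 0 < ρ)
    (hball : ∀ z ∈ Metric.ball x ρ, ∃ a ∈ closure W, dist z a < r) : x ∈ W := by
  by_contra hx
  obtain ⟨f, hf⟩ := geometric_hahn_banach_open_point hW hWo hx
  obtain ⟨a₀, ha₀, har⟩ := hball x (Metric.mem_ball_self hρ)
  have hr0 : 0 < r := dist_nonneg.trans_lt har
  obtain ⟨w, hw⟩ := closure_nonempty_iff.1 ⟨a₀, ha₀⟩
  set v := (InnerProductSpace.toDual ℝ (𝔼 n)).symm f with hv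
  have hfv : ∀ z, f z = inner ℝ v z := fun z => by
    rw [hv, InnerProductSpace.toDual_symm_apply]
  have hv0 : v ≠ 0 := fun h => by
    have := hf w hw
    rw [hfv, hfv, h, inner_zero_left, inner_zero_left] at this
    exact lt_irrefl _ this
  have hvpos : 0 < ‖v‖ := norm_pos_iff.2 hv0
  -- Moving from `x` by `r` along the normal `v` of a separating hyperplane stays in the ball but
  -- gets at least `r` away from `closure W`.
  obtain ⟨a, ha, haz⟩ := hball (x + (r / ‖v‖) • v) (by
    rw [Metric.mem_ball, dist_eq_norm, add_sub_cancel_left, norm_smul,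
      Real.norm_of_nonneg (by positivity), div_mul_cancel₀ _ hvpos.ne']
    exact hr)
  have hfa : f a ≤ f x := by
    have hsub : closure W ⊆ {z | f z ≤ f x} :=
      closure_minimal (fun z hz => (hf z hz).le) (isClosed_le f.continuous continuous_const)
    exact hsub ha
  have h1 : f (x + (r / ‖v‖) • v) = f x + r * ‖v‖ := by
    rw [map_add, map_smul, hfv v, real_inner_self_eq_norm_sq, smul_eq_mul]
    field_simp
  have h2 : f (x + (r / ‖v‖) • v) - f a ≤ ‖v‖ * dist (x + (r / ‖v‖) • v) a := by
    rw [← map_sub, hfv, dist_eq_norm]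
    exact real_inner_le_norm _ _
  have h3 : ‖v‖ * dist (x + (r / ‖v‖) • v) a < ‖v‖ * r := by gcongr
  linarith

theorem volume_le_of_forall_eventually_mem {n : ℕ} {Ω : Set (𝔼 n)} (hΩ : MeasurableSet Ω)
    {W : ℕ → Set (𝔼 n)} (hW : ∀ k, MeasurableSet (W k)) {V : ℝ≥0∞} (hV : ∀ k, volume (W k) ≤ V)
    (h : ∀ x ∈ Ω, ∀ᶠ k in atTop, x ∈ W k) : volume Ω ≤ V := by
  calc volume Ω = ∫⁻ x, Ω.indicator 1 x := (lintegral_indicator_one hΩ).symm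
    _ ≤ ∫⁻ x, liminf (fun k => (W k).indicator (1 : (𝔼 n) → ℝ≥0∞) x) atTop := by
      refine lintegral_mono fun x => ?_
      by_cases hx : x ∈ Ω
      · rw [Set.indicator_of_mem hx]
        refine (le_liminf_of_le (by isBoundedDefault) ?_)
        filter_upwards [h x hx] with k hk
        rw [Set.indicator_of_mem hk]
      · rw [Set.indicator_of_notMem hx]; exact zero_le
    _ ≤ liminf (fun k => ∫⁻ x, (W k).indicator (1 : (𝔼 n) → ℝ≥0∞) x) atTop :=
      lintegral_liminf_le fun k => measurable_one.indicator (hW k)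
    _ ≤ liminf (fun _ : ℕ => V) atTop := by
      refine liminf_le_liminf (Eventually.of_forall fun k => ?_)
      simp only [lintegral_indicator_one (hW k)]
      exact hV k
    _ = V := liminf_const V

/-- A point of the `δ`-neighbourhood of a convex set `K` that contains the ball `B(z, r)` is moved
into the interior of `K` by the homothety of centre `z` and ratio `(1 + δ / r)⁻¹`. -/
theorem mem_interior_of_homothety {n : ℕ} {K : Set (𝔼 n)} (hK : Convex ℝ K) {z x : 𝔼 n} {r δ : ℝ}
    (hr : 0 < r) (hδ : 0 < δ) (hball : Metric.ball z r ⊆ K)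
    (hx : ∃ y ∈ K, dist (z + (1 + δ / r) • (x - z)) y < δ) : x ∈ interior K := by
  obtain ⟨y, hy, hyd⟩ := hx
  set t := 1 + δ / r with ht
  have hq : 0 < δ / r := by positivity
  have ht0 : 0 < t := by linarith
  set w := z + t • (x - z) with hw
  -- With `w` the dilated point, `x = t⁻¹ y + (1 - t⁻¹) p` where `p = z + (r/δ)(w - y)`; since `w`
  -- is within `δ` of `y`, the point `p` lies in `B(z, r)`.
  have hp : z + (r / δ) • (w - y) ∈ interior K := by
    refine (interior_maximal hball Metric.isOpen_ball) ?_
    rw [Metric.mem_ball, dist_eq_norm, add_sub_cancel_left, norm_smul,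
      Real.norm_of_nonneg (by positivity), ← dist_eq_norm]
    calc r / δ * dist w y < r / δ * δ := by gcongr
      _ = r := by field_simp
  have h := hK.combo_self_interior_mem_interior hy hp (a := t⁻¹) (b := t⁻¹ * (δ / r))
    (by positivity) (by positivity) (by rw [← mul_one_add, ← ht]; field_simp)
  convert h using 1
  have e : t⁻¹ * (δ / r) * (r / δ) = t⁻¹ := by field_simp
  have e2 : t⁻¹ * (δ / r) = 1 - t⁻¹ := by
    have : δ / r = t - 1 := by rw [ht]; ring
    rw [this]; field_simp
  rw [smul_add, smul_smul, e, e2, hw]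
  have e3 : t⁻¹ • t • (x - z) = x - z := by rw [smul_smul, inv_mul_cancel₀ ht0.ne', one_smul]
  have : t⁻¹ • y + ((1 - t⁻¹) • z + t⁻¹ • (z + t • (x - z) - y)) = z + t⁻¹ • t • (x - z) := by
    module
  rw [this, e3]; abel

/-- Blaschke selection for convex sets of volume `1` of bounded diameter: after homotheties with
ratios tending to `1`, a subsequence exhausts a convex open set of volume `1` from inside. -/
theorem exists_subseq_homothety {n : ℕ} {Ω : ℕ → Set (𝔼 n)} (hΩ : ∀ k, Ω k ∈ convexUnitVolume n)
    {x : ℕ → 𝔼 n} {D : ℝ} (hD : ∀ k, Ω k ⊆ Metric.ball (x k) D) :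
    ∃ Ω₀ ∈ convexUnitVolume n, ∃ s : ℕ → ℕ, StrictMono s ∧ ∃ (c : ℕ → 𝔼 n) (t : ℕ → ℝ),
      (∀ k, 0 < t k) ∧ Tendsto t atTop (𝓝 1) ∧
      (∀ k y, c k + t k • y ∈ Ω (s k) → y ∈ Ω₀) ∧
      ∀ y ∈ Ω₀, ∀ᶠ k in atTop, c k + t k • y ∈ Ω (s k) := by
  let W : ℕ → Set (𝔼 n) := fun k => (fun y => x k + y) ⁻¹' Ω k
  have hWo : ∀ k, IsOpen (W k) := fun k => (hΩ k).2.1.preimage (by fun_prop)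
  have hWc : ∀ k, Convex ℝ (W k) := fun k => (hΩ k).1.translate_preimage_right (x k)
  have hWv : ∀ k, volume (W k) = 1 := fun k => by
    simp only [W]; rw [measure_preimage_add]; exact (hΩ k).2.2
  have hWD : ∀ k, W k ⊆ Metric.closedBall 0 D := fun k y hy => by
    have := hD k hy
    rw [Metric.mem_ball, dist_eq_norm, add_sub_cancel_left] at this
    simpa using this.le
  have hWne : ∀ k, (W k).Nonempty := fun k =>
    nonempty_of_measure_ne_zero (μ := (volume : Measure (𝔼 n))) (by rw [hWv k]; exact one_ne_zero)
  let A : ℕ → TopologicalSpace.NonemptyCompacts (𝔼 n) := fun k =>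
    { carrier := closure (W k)
      isCompact' := (Metric.isBounded_closedBall.subset (hWD k)).isCompact_closure
      nonempty' := (hWne k).closure }
  obtain ⟨K, -, s, hs, hlim⟩ := (TopologicalSpace.NonemptyCompacts.isCompact_subsets_of_isCompact
    (isCompact_closedBall (0 : 𝔼 n) D)).tendsto_subseq (x := A) fun k =>
      closure_minimal (hWD k) Metric.isClosed_closedBall
  have hKc : Convex ℝ (K : Set (𝔼 n)) :=
    convex_of_tendsto_nonemptyCompacts (A := A ∘ s) (fun k => (hWc (s k)).closure) hlim
  have hdist : Tendsto (fun k => dist (A (s k)) K) atTop (𝓝 0) := tendsto_iff_dist_tendsto_zero.1 hlim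
  -- Every closed thickening of `K` contains some `W (s k)`, of volume 1, and the volumes of these
  -- thickenings decrease to that of the compact set `K`.
  have hKvol : 1 ≤ volume (K : Set (𝔼 n)) := by
    refine ge_of_tendsto ((tendsto_measure_cthickening_of_isCompact (μ := volume)
      K.isCompact).mono_left (nhdsWithin_le_nhds (s := Set.Ioi (0 : ℝ)))) ?_
    filter_upwards [self_mem_nhdsWithin] with δ hδ
    obtain ⟨k, hk⟩ := (hdist.eventually (gt_mem_nhds (show (0 : ℝ) < δ from hδ))).exists
    rw [← hWv (s k)]
    refine measure_mono fun y hy => ?_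
    obtain ⟨z, hz, hyz⟩ := TopologicalSpace.NonemptyCompacts.exists_dist_lt hk (subset_closure hy)
    exact Metric.mem_cthickening_of_dist_le y z δ _ hz hyz.le
  set Ω₀ := interior (K : Set (𝔼 n))
  have hvol : volume Ω₀ = volume (K : Set (𝔼 n)) := by
    refine le_antisymm (measure_mono interior_subset) ?_
    have h1 : (K : Set (𝔼 n)) ⊆ Ω₀ ∪ frontier (K : Set (𝔼 n)) := by
      intro y hy
      by_cases h : y ∈ Ω₀
      · exact Or.inl h
      · exact Or.inr ⟨subset_closure hy, h⟩
    calc _ ≤ _ := measure_mono h1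
      _ ≤ volume Ω₀ + volume (frontier (K : Set (𝔼 n))) := measure_union_le _ _
      _ = volume Ω₀ := by rw [hKc.addHaar_frontier volume, add_zero]
  have hmem : ∀ y ρ, 0 < ρ → Metric.ball y ρ ⊆ K → ∀ k, dist (A (s k)) K < ρ → y ∈ W (s k) := by
    intro y ρ hρ hball k hk
    obtain ⟨r, hr, hrρ⟩ := exists_between hk
    refine mem_of_ball_subset_thickening (hWc _) (hWo _) hrρ hρ fun z hz => ?_
    rw [dist_comm] at hr
    exact TopologicalSpace.NonemptyCompacts.exists_dist_lt hr (hball hz)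
  have hev : ∀ y ∈ Ω₀, ∀ᶠ k in atTop, y ∈ W (s k) := by
    intro y hy
    obtain ⟨ρ, hρ, hball⟩ := Metric.isOpen_iff.1 isOpen_interior y hy
    filter_upwards [hdist.eventually (gt_mem_nhds hρ)] with k hk
    exact hmem y ρ hρ (hball.trans interior_subset) k hk
  have hvol1 : volume Ω₀ = 1 :=
    le_antisymm (volume_le_of_forall_eventually_mem isOpen_interior.measurableSet
      (fun k => (hWo (s k)).measurableSet) (fun k => (hWv (s k)).le) hev) (hvol ▸ hKvol)
  have hmem₀ : Ω₀ ∈ convexUnitVolume n := ⟨hKc.interior, isOpen_interior, hvol1⟩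
  obtain ⟨z, hz⟩ := nonempty_of_mem_convexUnitVolume hmem₀
  obtain ⟨r, hr, hzball⟩ := Metric.isOpen_iff.1 isOpen_interior z hz
  -- The extra `1/(k+1)` makes `δ k` positive and strictly larger than the Hausdorff distance, even
  -- when that distance is 0.
  let δ : ℕ → ℝ := fun k => dist (A (s k)) K + 1 / ((k : ℝ) + 1)
  have hδpos : ∀ k, 0 < δ k := fun k => by positivity
  have hδlim : Tendsto δ atTop (𝓝 0) := by
    have := hdist.add (tendsto_one_div_add_atTop_nhds_zero_nat (𝕜 := ℝ))
    rwa [add_zero] at this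
  let t : ℕ → ℝ := fun k => 1 + δ k / r
  have htpos : ∀ k, 0 < t k := fun k => by have := hδpos k; positivity
  have htlim : Tendsto t atTop (𝓝 1) := by
    simpa using (hδlim.div_const r).const_add 1
  have hform : ∀ k y, x (s k) + (z - t k • z) + t k • y = x (s k) + (z + t k • (y - z)) := by
    intro k y; rw [smul_sub]; abel
  refine ⟨Ω₀, hmem₀, s, hs, fun k => x (s k) + (z - t k • z), t, htpos, htlim, ?_, ?_⟩
  · intro k y hy
    rw [hform] at hy
    have hd : dist (A (s k)) K < δ k := by
      simp only [δ]; linarith [show (0 : ℝ) < 1 / ((k : ℝ) + 1) by positivity]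
    exact mem_interior_of_homothety hKc hr (hδpos k) (hzball.trans interior_subset)
      (TopologicalSpace.NonemptyCompacts.exists_dist_lt hd (subset_closure hy))
  · intro y hy
    obtain ⟨ρ, hρ, hball⟩ := Metric.isOpen_iff.1 isOpen_interior y hy
    have hylim : Tendsto (fun k => z + t k • (y - z)) atTop (𝓝 y) := by
      have := (htlim.smul_const (y - z)).const_add z
      simpa using this
    filter_upwards [hylim.eventually (Metric.ball_mem_nhds y (half_pos hρ)),
      hdist.eventually (gt_mem_nhds (half_pos hρ))] with k h1 h2
    rw [hform]
    -- The dilated point moves with `k` but ends up within `ρ/2` of `y`, so the ball of radius `ρ/2`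
    -- about it stays in `K`.
    refine hmem _ (ρ / 2) (half_pos hρ) (fun p hp => interior_subset (hball ?_)) k h2
    have hp' : dist p (z + t k • (y - z)) < ρ / 2 := hp
    have h1' : dist (z + t k • (y - z)) y < ρ / 2 := h1
    rw [Metric.mem_ball]
    linarith [dist_triangle p (z + t k • (y - z)) y]

/-! ### Scaling of the energy and existence of an optimal domain -/

theorem C1c_comp_homothety {n : ℕ} {Ω : Set (𝔼 n)} {φ : (𝔼 n) → ℝ} (hφ : φ ∈ C1c Ω) (c : 𝔼 n)
    {t : ℝ} (ht : 0 < t) :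
    (fun x => φ (c + t • x)) ∈ C1c ((fun x => c + t • x) ⁻¹' Ω) := by
  let g : (𝔼 n) ≃ₜ 𝔼 n := (Homeomorph.smulOfNeZero t ht.ne').trans (Homeomorph.addLeft c)
  have e : (fun x => φ (c + t • x)) = φ ∘ g := rfl
  refine ⟨hφ.1.comp (by fun_prop), ?_, ?_⟩
  · rw [e]; exact hφ.2.1.comp_homeomorph g
  · rw [e, tsupport_comp_eq_preimage]
    exact Set.preimage_mono hφ.2.2

theorem lintegral_comp_homothety {n : ℕ} (c : 𝔼 n) {t : ℝ} (ht : 0 < t) {f : (𝔼 n) → ℝ≥0∞}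
    (hf : Measurable f) :
    ∫⁻ x, f (c + t • x) = ENNReal.ofReal (t ^ (-(n : ℝ))) * ∫⁻ x, f x := by
  rw [lintegral_comp_smul_eq ht (f := fun x => f (c + x)) (by fun_prop),
    lintegral_add_left_eq_self f c]

theorem regionalEnergy_comp_homothety {n : ℕ} (σ : ℝ) {Ω : Set (𝔼 n)} (hΩ : MeasurableSet Ω)
    {u : (𝔼 n) → ℝ} (hu : Measurable u) (c : 𝔼 n) {t : ℝ} (ht : 0 < t) :
    regionalEnergy σ ((fun x => c + t • x) ⁻¹' Ω) (fun x => u (c + t • x)) =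
      ENNReal.ofReal (t ^ (-(n : ℝ)) * t ^ (2 * σ)) * regionalEnergy σ Ω u := by
  have hg : Measurable fun x : 𝔼 n => c + t • x := by fun_prop
  have hG : Measurable ((Ω ×ˢ Ω).indicator
      (fun p : (𝔼 n) × (𝔼 n) => ENNReal.ofReal ((u p.1 - u p.2) ^ 2))) :=
    Measurable.indicator (by fun_prop) (hΩ.prod hΩ)
  rw [regionalEnergy_eq_translates σ (hg hΩ)
    (show Measurable fun x => u (c + t • x) from hu.comp hg), regionalEnergy_eq_translates σ hΩ hu]
  set G := (Ω ×ˢ Ω).indicator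
      (fun p : (𝔼 n) × (𝔼 n) => ENNReal.ofReal ((u p.1 - u p.2) ^ 2)) with hGdef
  have h1 : ∀ h x : 𝔼 n, (((fun x => c + t • x) ⁻¹' Ω) ×ˢ ((fun x => c + t • x) ⁻¹' Ω)).indicator
      (fun p => ENNReal.ofReal ((u (c + t • p.1) - u (c + t • p.2)) ^ 2)) (x, x - h) =
      G (c + t • x, c + t • x - t • h) := by
    intro h x
    have e : c + t • x - t • h = c + t • (x - h) := by rw [smul_sub]; abel
    rw [e, hGdef]
    rfl
  simp only [h1]
  have h2 : ∀ h : 𝔼 n, ∫⁻ x, G (c + t • x, c + t • x - t • h) =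
      ENNReal.ofReal (t ^ (-(n : ℝ))) * ∫⁻ x, G (x, x - t • h) := fun h =>
    lintegral_comp_homothety c ht (f := fun y => G (y, y - t • h)) (by fun_prop)
  have h3 : Measurable fun h : 𝔼 n => ∫⁻ x, G (x, x - h) := by
    have : Measurable (Function.uncurry fun h x : 𝔼 n => G (x, x - h)) := hG.comp (by fun_prop)
    exact this.lintegral_prod_right
  simp only [h2, mul_left_comm (kern σ _)]
  rw [lintegral_const_mul' _ _ ENNReal.ofReal_ne_top,
    lintegral_kern_mul_comp_smul σ ht (f := fun h => ∫⁻ x, G (x, x - h)) h3, ← mul_assoc,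
    ← ENNReal.ofReal_mul (by positivity)]

/-- Pull back of a normalized test function by a homothety. -/
theorem exists_C1c_homothety {n : ℕ} (σ : ℝ) {Ω : Set (𝔼 n)} (hΩ : IsOpen Ω) {φ : (𝔼 n) → ℝ}
    (hφ : φ ∈ C1c Ω) (h1 : eLpNorm φ 2 volume = 1) (c : 𝔼 n) {t : ℝ} (ht : 0 < t) :
    ∃ ψ ∈ C1c ((fun x => c + t • x) ⁻¹' Ω), eLpNorm ψ 2 volume = 1 ∧
      regionalEnergy σ ((fun x => c + t • x) ⁻¹' Ω) ψ =
        ENNReal.ofReal (t ^ (2 * σ)) * regionalEnergy σ Ω φ := by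
  have hm := (C1c_continuous hφ).measurable
  have hsq : (t ^ ((n : ℝ) / 2)) ^ 2 * t ^ (-(n : ℝ)) = 1 := by
    rw [← Real.rpow_mul_natCast ht.le, ← Real.rpow_add ht]
    simp
  -- The factor `t^{n/2}` offsets the Jacobian `t^{-n}` in the squared `L²` norm; the energy keeps
  -- the factor `t^{2σ}`.
  refine ⟨t ^ ((n : ℝ) / 2) • fun x => φ (c + t • x), C1c_smul (C1c_comp_homothety hφ c ht) _,
    ?_, ?_⟩
  · suffices h : eLpNorm (t ^ ((n : ℝ) / 2) • fun x => φ (c + t • x)) 2 volume ^ 2 = 1 by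
      replace h := h.trans (one_pow 2).symm
      exact le_antisymm ((ENNReal.pow_le_pow_left_iff two_ne_zero).1 h.le)
        ((ENNReal.pow_le_pow_left_iff two_ne_zero).1 h.ge)
    rw [eLpNorm_two_sq]
    simp only [Pi.smul_apply, smul_eq_mul, mul_pow, ENNReal.ofReal_mul (sq_nonneg (t ^ ((n : ℝ) / 2)))]
    rw [lintegral_const_mul' _ _ ENNReal.ofReal_ne_top,
      lintegral_comp_homothety c ht (f := fun x => ENNReal.ofReal (φ x ^ 2)) (by fun_prop),
      ← eLpNorm_two_sq, h1, one_pow, mul_one, ← ENNReal.ofReal_mul (by positivity), hsq,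
      ENNReal.ofReal_one]
  · rw [regionalEnergy_const_smul, regionalEnergy_comp_homothety σ hΩ.measurableSet hm c ht,
      ← mul_assoc, ← ENNReal.ofReal_mul (by positivity), ← mul_assoc, hsq, one_mul]

theorem convexUnitVolume_nonempty {n : ℕ} (hn : 0 < n) : (convexUnitVolume n).Nonempty := by
  set V := volume (Metric.ball (0 : 𝔼 n) 1)
  have hV0 : V ≠ 0 := (Metric.measure_ball_pos volume _ one_pos).ne'
  have hVt : V ≠ ∞ := measure_ball_lt_top.ne
  set v := V.toReal with hv'
  have hv : 0 < v := ENNReal.toReal_pos hV0 hVt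
  set r := v⁻¹ ^ ((n : ℝ)⁻¹)
  have hr : 0 < r := by positivity
  refine ⟨Metric.ball 0 r, convex_ball _ _, Metric.isOpen_ball, ?_⟩
  rw [Measure.addHaar_ball_of_pos _ _ hr, finrank_euclideanSpace_fin]
  change _ * V = 1
  rw [← ENNReal.ofReal_toReal hVt, ← hv', ← ENNReal.ofReal_mul (by positivity),
    Real.rpow_inv_natCast_pow (by positivity) hn.ne', inv_mul_cancel₀ hv.ne', ENNReal.ofReal_one]

theorem exists_rayleighInf_minimizer {n : ℕ} (hn : 0 < n) {σ : ℝ} (hσ : 1 / 2 < σ) (hσ' : σ < 1) :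
    ∃ Ω₀ ∈ convexUnitVolume n, ∀ Ω ∈ convexUnitVolume n, rayleighInf σ Ω₀ ≤ rayleighInf σ Ω := by
  have hσ0 : 0 < σ := by linarith
  have hfin : ∀ Ω ∈ convexUnitVolume n, rayleighInf σ Ω < ∞ := fun Ω hΩ =>
    rayleighInf_lt_top hn hσ0 hσ' hΩ.2.1 (nonempty_of_mem_convexUnitVolume hΩ)
  set m : ℝ≥0∞ := ⨅ Ω ∈ convexUnitVolume n, rayleighInf σ Ω with hm
  have hmt : m ≠ ∞ := by
    obtain ⟨Ω, hΩ⟩ := convexUnitVolume_nonempty hn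
    exact ((iInf₂_le Ω hΩ).trans_lt (hfin Ω hΩ)).ne
  have hex : ∀ k : ℕ, ∃ Ω ∈ convexUnitVolume n, ∃ φ ∈ C1c Ω, eLpNorm φ 2 volume = 1 ∧
      regionalEnergy σ Ω φ < m + (k + 1 : ℝ≥0∞)⁻¹ := by
    intro k
    have h1 : m < m + (k + 1 : ℝ≥0∞)⁻¹ := ENNReal.lt_add_right hmt (by
      simp only [ne_eq, ENNReal.inv_eq_zero]; finiteness)
    obtain ⟨Ω, hΩ, h2⟩ : ∃ Ω ∈ convexUnitVolume n, rayleighInf σ Ω < m + (k + 1 : ℝ≥0∞)⁻¹ := by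
      simpa [hm, iInf_lt_iff] using h1
    rw [rayleighInf] at h2
    simp only [iInf_lt_iff] at h2
    obtain ⟨φ, hφ, h⟩ := h2
    exact ⟨Ω, hΩ, φ, hφ.1, hφ.2, h⟩
  choose Ω hΩ φ hφ h1 hI using hex
  have hinv : Tendsto (fun k : ℕ => ((k : ℝ≥0∞) + 1)⁻¹) atTop (𝓝 0) := by
    have := (tendsto_add_atTop_iff_nat 1).2 ENNReal.tendsto_inv_nat_nhds_zero
    simpa using this
  have hlim : Tendsto (fun k => regionalEnergy σ (Ω k) (φ k)) atTop (𝓝 m) :=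
    tendsto_of_tendsto_of_tendsto_of_le_of_le tendsto_const_nhds
      (by simpa using tendsto_const_nhds.add hinv)
      (fun k => (iInf₂_le (Ω k) (hΩ k)).trans (iInf₂_le (φ k) ⟨hφ k, h1 k⟩)) fun k => (hI k).le
  obtain ⟨R, hR, hhalf⟩ := exists_radius_half_ball (n := n) hσ (Λ := m + 1) (by finiteness)
  obtain ⟨D, hD⟩ := exists_subset_ball_of_half_ball (n := n) hR
  choose x hx hxR using fun k => hhalf (hΩ k).2.1 (φ k) (hφ k) (h1 k) ((hI k).le.trans (by
    gcongr
    rw [ENNReal.inv_le_one]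
    exact le_add_self))
  obtain ⟨Ω₀, hΩ₀, s, hs, c, t, htpos, htlim, hsub, hev⟩ :=
    exists_subseq_homothety hΩ (x := x) (D := D) fun k => hD _ (hΩ k) _ (hx k) (hxR k)
  -- Pulled back, the test functions live in subdomains of the single set `Ω₀`, and their energies
  -- still tend to `m` because `t k → 1`.
  choose ψ hψ hψ1 hψI using fun k =>
    exists_C1c_homothety σ (hΩ (s k)).2.1 (hφ (s k)) (h1 (s k)) (c k) (htpos k)
  have hlim' : Tendsto (fun k => regionalEnergy σ ((fun y => c k + t k • y) ⁻¹' Ω (s k)) (ψ k))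
      atTop (𝓝 m) := by
    simp only [hψI]
    have h2 : Tendsto (fun k => ENNReal.ofReal (t k ^ (2 * σ))) atTop (𝓝 1) := by
      have := (ENNReal.continuous_ofReal.tendsto _).comp
        (htlim.rpow_const (p := 2 * σ) (Or.inl one_ne_zero))
      rwa [Real.one_rpow, ENNReal.ofReal_one] at this
    simpa using ENNReal.Tendsto.mul h2 (Or.inr hmt) (hlim.comp hs.tendsto_atTop)
      (Or.inr ENNReal.one_ne_top)
  obtain ⟨u, hu, hu1, huI⟩ := exists_mem_HRing_of_tendsto hσ hΩ₀.2.1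
    (isBounded_of_mem_convexUnitVolume hΩ₀)
    (fun k => (hΩ (s k)).2.1.preimage (by fun_prop : Continuous fun y => c k + t k • y))
    (fun k y hy => hsub k y hy) hev hψ hψ1 hmt hlim'
  refine ⟨Ω₀, hΩ₀, fun Ω' hΩ' => ?_⟩
  have h3 := rayleighInf_mul_le_of_mem_HRing hn hσ0 hσ' hΩ₀.2.1
    (nonempty_of_mem_convexUnitVolume hΩ₀) hu
  rw [hu1, one_pow, mul_one] at h3
  exact h3.trans (huI.trans (iInf₂_le Ω' hΩ'))

theorem mainTheorem2 (n : ℕ) (hn : 2 ≤ n) (σ : ℝ) (hσ : 1 / 2 < σ) (hσ' : σ < 1) :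
    (∀ Ω ∈ convexUnitVolume n, IsLeast (eigenvalues σ Ω) (firstEigenvalue σ Ω)) ∧
      ∃ Ω₀ ∈ convexUnitVolume n, ∀ Ω ∈ convexUnitVolume n,
        firstEigenvalue σ Ω₀ ≤ firstEigenvalue σ Ω := by
  have hn0 : 0 < n := by omega
  have hfirst : ∀ Ω ∈ convexUnitVolume n, firstEigenvalue σ Ω = (rayleighInf σ Ω).toReal :=
    fun Ω hΩ => firstEigenvalue_eq hn0 hσ hσ' hΩ.2.1 (nonempty_of_mem_convexUnitVolume hΩ)
      (isBounded_of_mem_convexUnitVolume hΩ)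
  refine ⟨fun Ω hΩ => ?_, ?_⟩
  · rw [hfirst Ω hΩ]
    exact isLeast_eigenvalues hn0 hσ hσ' hΩ.2.1 (nonempty_of_mem_convexUnitVolume hΩ)
      (isBounded_of_mem_convexUnitVolume hΩ)
  · obtain ⟨Ω₀, hΩ₀, hmin⟩ := exists_rayleighInf_minimizer hn0 hσ hσ'
    refine ⟨Ω₀, hΩ₀, fun Ω hΩ => ?_⟩
    rw [hfirst Ω hΩ, hfirst Ω₀ hΩ₀]
    exact ENNReal.toReal_mono (rayleighInf_lt_top hn0 (by linarith) hσ' hΩ.2.1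
      (nonempty_of_mem_convexUnitVolume hΩ)).ne (hmin Ω hΩ)
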